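/- Let $i,j>0$ with $i+j=1$, and let $\theta\in\mathbb R$, $c(\theta)>0$ satisfy $q^{1/i}|q\theta-p|>c(\theta)$ for all $p\in\mathbb Z$ and all integers $q\ge 1$. Let $\Theta=\{\theta\}\times[0,1]$, identified with $[0,1]$ through the second coordinate. Let $\mu$ be a Borel probability measure on $\Theta$ that satisfies a power law: there are $\beta,b_1,b_2>0$ with $b_1r^\beta\le\mu(B(x,r))\le b_2r^\beta$ for all $x\in\operatorname{supp}\mu$ and $0<r<1$, where $B(x,r)$ is the closed ball; for an interval $I=B(x,r)$ and $\gamma\ge 0$ write $\gamma I=B(x,\gamma r)$. Let $R\ge 1$ be an integer and put $$\alpha=\frac{\beta ij}{4},\quad \lambda=\frac 3j,\quad c_1=\min\Big\{c(\theta)R^{1+\alpha},\tfrac14R^{-3i/j}\Big\},\quad c=\frac{c_1}{R^{1+\alpha}}.$$ *Lines.* For integers $A,B,C$ with $B>0$ and $\gcd(A,B,C)=1$ let $L=L(A,B,C)$ be the line $Ax-By+C=0$, let $H(L)=B\max\{|A|^{1/i},B^{1/j}\}$, and let $$\Delta(L)=\Big\{(\theta,y)\in\Theta:\ |A\theta-By+C|\le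 \frac{c}{\max\{|A|^{1/i},B^{1/j}\}}\Big\}.$$ For integers $n,\ell,k\ge0$ let $C(n)$ be the set of these lines with $R^{n-1}\le H(L)<R^n$, let $C(n,\ell)$ be the set of $L\in C(n)$ with $R^{-\lambda(\ell+1)}R^{nj/(j+1)}\le B<R^{-\lambda\ell}R^{nj/(j+1)}$, and let $C(n,\ell,k)$ be the set of $L\in C(n,\ell)$ with $2^kR^{n-1}\le H(L)<2^{k+1}R^{n-1}$. *Intervals.* Let $\mathcal I_0$ be a pairwise disjoint subcollection of $\tilde{\mathcal I}_0=\{B(y,\frac12c_1):y\in\operatorname{supp}\mu\}$ such that $\bigcup_{I\in\tilde{\mathcal I}_0}I\subseteq\bigcup_{I\in\mathcal I_0}5I$. Recursively, for $n\ge 0$ and each $I'\in\mathcal I_n$ put $I'^-=(1-R^{-\alpha})I'$, let $\mathcal I_{n+1}(I')$ be a pairwise disjoint subcollection of $\tilde{\mathcal I}_{n+1}(I')=\{B(y,\frac12c_1R^{-n-1}):y\in\operatorname{supp}\mu\cap I'^-\}$ such that $\bigcup_{I\in\tilde{\mathcal I}_{n+1}(I')}I\subseteq\bigcup_{I\in\mathcal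 I_{n+1}(I')}5I$, and let $\mathcal I_{n+1}=\bigcup_{I'\in\mathcal I_n}\mathcal I_{n+1}(I')$. Let $\mathcal J_0=\mathcal I_0$ and $$\mathcal J_{n+1}=\Big\{I\in\bigcup_{J\in\mathcal J_n}\mathcal I_{n+1}(J):\ \Delta(L)\cap I=\varnothing\ \text{ for all } L\in C(n)\Big\}.$$ The choices of the subcollections are arbitrary. **Theorem.** Let $\varepsilon\in\mathbb R$ and $R$ satisfy $$R^{-\varepsilon}+R^{\varepsilon-\alpha\beta}<\frac12\Big(\frac{b_1}{4b_2}\Big)^2\qquad\text{and}\qquad R^{\alpha\beta-\left(\frac{4}{\beta ij}+1\right)\varepsilon}>4^{\frac{2}{ij}+2}\,\frac{b_2}{b_1}.$$ Then for all integers $n,\ell,k\ge0$ with $\ell\le n$ and every $J\in\mathcal J_{n-\ell}$, $$\#\{I\in\mathcal I_{n+1}:\ I\subseteq J \text{ and } I\cap\Delta(L)\ne\varnothing \text{ for some } L\in C(n,\ell,k)\}\le R^{\beta-\varepsilon}.$$ -/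

import Mathlib

open MeasureTheory

noncomputable section

/-- A Borel measure on a metric space satisfies a power law with exponent `β` and constants
`b₁`, `b₂`. -/
def PowerLaw {X : Type*} [PseudoMetricSpace X] [MeasurableSpace X]
    (μ : Measure X) (β b₁ b₂ : ℝ) : Prop :=
  0 < β ∧ 0 < b₁ ∧ 0 < b₂ ∧
    ∀ x ∈ μ.support, ∀ r : ℝ, 0 < r → r < 1 →
      ENNReal.ofReal (b₁ * r ^ β) ≤ μ (Metric.closedBall x r) ∧
        μ (Metric.closedBall x r) ≤ ENNReal.ofReal (b₂ * r ^ β)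

/-- `c` is a constant witnessing that `θ` is badly approximable with weight `i`. -/
def IsBadConstant (i θ c : ℝ) : Prop :=
  0 < c ∧ ∀ (p : ℤ) (q : ℕ), 0 < q → c < (q : ℝ) ^ (1 / i) * |(q : ℝ) * θ - (p : ℝ)|

/-- The numerical data of the construction: the weights `i`, `j`, the abscissa `θ` of the vertical
segment `{θ} × [0, 1]`, the constant `c(θ)`, the power law exponent `β`, and the integer `R`. The
segment is identified with `[0, 1]` through the second coordinate. -/
structure Params where
  i : ℝ
  j : ℝ
  θ : ℝ
  cθ : ℝ
  β : ℝ
  R : ℕ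

/-- The triple of coefficients of the line `A x - B y + C = 0`. -/
structure Line where
  A : ℤ
  B : ℤ
  C : ℤ

namespace Params

variable (P : Params)

/-- `α = β i j / 4`. -/
def α : ℝ := P.β * P.i * P.j / 4

/-- `c₁ = min {c(θ) R^(1+α), R^(-3i/j) / 4}`. -/
def c₁ : ℝ :=
  min (P.cθ * (P.R : ℝ) ^ (1 + P.α)) (1 / 4 * (P.R : ℝ) ^ (-(3 * P.i / P.j)))

/-- `c = c₁ / R^(1+α)`. -/
def c : ℝ := P.c₁ / (P.R : ℝ) ^ (1 + P.α)

/-- The exponent `3 / j`. -/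
def lam : ℝ := 3 / P.j

/-- `max {|A|^(1/i), |B|^(1/j)}`. -/
def size (L : Line) : ℝ :=
  max (|(L.A : ℝ)| ^ (1 / P.i)) (|(L.B : ℝ)| ^ (1 / P.j))

/-- The height `H(A, B) = B max {|A|^(1/i), |B|^(1/j)}`. -/
def height (L : Line) : ℝ := (L.B : ℝ) * P.size L

/-- `Δ(L)`: the points `(θ, y)`, `y ∈ [0, 1]`, that are too close to the line `L`. -/
def Δ (L : Line) : Set ℝ :=
  {y | y ∈ Set.Icc (0 : ℝ) 1 ∧
    |(L.A : ℝ) * P.θ - (L.B : ℝ) * y + (L.C : ℝ)| ≤ P.c / P.size L}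

/-- `C(n)`. The normalisation `gcd(A, B, C) = 1`, `B > 0` makes the triple unique for each line. -/
def linesAt (n : ℕ) : Set Line :=
  {L | Int.gcd (Int.gcd L.A L.B) L.C = 1 ∧ 0 < L.B ∧
    (P.R : ℝ) ^ ((n : ℝ) - 1) ≤ P.height L ∧ P.height L < (P.R : ℝ) ^ (n : ℝ)}

/-- `C(n, ℓ)`. -/
def linesAtLevel (n l : ℕ) : Set Line :=
  {L | L ∈ P.linesAt n ∧
    (P.R : ℝ) ^ (-(P.lam * ((l : ℝ) + 1))) * (P.R : ℝ) ^ ((n : ℝ) * P.j / (P.j + 1)) ≤ (L.B : ℝ) ∧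
    (L.B : ℝ) < (P.R : ℝ) ^ (-(P.lam * (l : ℝ))) * (P.R : ℝ) ^ ((n : ℝ) * P.j / (P.j + 1))}

/-- `C(n, ℓ, k)`. -/
def linesAtLevelScale (n l k : ℕ) : Set Line :=
  {L | L ∈ P.linesAtLevel n l ∧
    (2 : ℝ) ^ k * (P.R : ℝ) ^ ((n : ℝ) - 1) ≤ P.height L ∧
    P.height L < (2 : ℝ) ^ (k + 1) * (P.R : ℝ) ^ ((n : ℝ) - 1)}

/-- The common radius `c₁ R^(-n) / 2` of the intervals of generation `n`. -/
def radius (n : ℕ) : ℝ := 1 / 2 * P.c₁ * (P.R : ℝ) ^ (-(n : ℝ))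

/-- The interval of generation `n` with centre `y`. -/
def interval (n : ℕ) (y : ℝ) : Set ℝ := Metric.closedBall y (P.radius n)

/-- The concentric subinterval `I⁻ = (1 - R^(-α)) I` of the interval of generation `n` with
centre `y`. -/
def shrunk (n : ℕ) (y : ℝ) : Set ℝ :=
  Metric.closedBall y ((1 - (P.R : ℝ) ^ (-P.α)) * P.radius n)

end Params

/-- A possible outcome of the `5r`-covering lemma: among the balls of radius `r` with centres
in `S`, those with centres in `T` are pairwise disjoint, and their fivefold enlargements cover
all of them. -/
def IsCoveringSelection (r : ℝ) (S T : Set ℝ) : Prop :=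
  T ⊆ S ∧ T.PairwiseDisjoint (fun y => Metric.closedBall y r) ∧
    ⋃ y ∈ S, Metric.closedBall y r ⊆ ⋃ y ∈ T, Metric.closedBall y (5 * r)

/-- The choices made in the construction. Intervals of a given generation have the same radius, so
that each is recorded by its centre: `root` is the collection of generation `0`, and `child n y` is
the collection of intervals of generation `n + 1` chosen for the interval of generation `n` with
centre `y`. -/
structure Choices where
  root : Set ℝ
  child : ℕ → ℝ → Set ℝ

namespace Choices

variable (T : Choices)

/-- The (centres of the) intervals of the collection `𝓘ₙ`. -/
def I : ℕ → Set ℝ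
  | 0 => T.root
  | n + 1 => ⋃ y ∈ I n, T.child n y

/-- The (centres of the) intervals of the collection `𝓙ₙ`: those that are left once the intervals
of generation `n + 1` that meet `Δ(L)` for some `L ∈ C(n)` are removed, for each `n`. -/
def J (P : Params) : ℕ → Set ℝ
  | 0 => T.root
  | n + 1 => {z | z ∈ (⋃ y ∈ J P n, T.child n y) ∧
      ∀ L ∈ P.linesAt n, P.Δ L ∩ P.interval (n + 1) z = ∅}

/-- The choices follow the rules of the construction for the measure `μ`. -/
def IsAdmissible (P : Params) (μ : Measure ℝ) : Prop :=
  IsCoveringSelection (P.radius 0) μ.support T.root ∧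
    ∀ n : ℕ, ∀ y ∈ T.I n,
      IsCoveringSelection (P.radius (n + 1)) (μ.support ∩ P.shrunk n y) (T.child n y)

/-- The (centres of the) intervals of `𝓘ₙ` contained in a given set. -/
def IWithin (P : Params) (n : ℕ) (S : Set ℝ) : Set ℝ :=
  {z | z ∈ T.I n ∧ P.interval n z ⊆ S}

end Choices

end

/-! The proof is by contradiction. Put `G = c₁ R^(-n)` and let `s = G R^l` be the length of `J`.
Suppose that more than `R^(β-ε)` intervals of generation `n+1` in `J` meet strips of the class, and
attach to each centre `z` one such line `f z`. Its ordinate over `θ` is within `3mG/2` of `z`, where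
`m = max {1/R, 2^(-k) R^(-α)}`.

Concurrency. The coefficients of the lines are so small that the determinant of any three of them,
an integer, is less than `1` in absolute value. Hence all these lines pass through one rational
point `(p/q, t/q)` (`Line.det_eq_zero`, `Params.exists_common_point`).

Counting. The power law bounds the number of disjoint intervals with centres in the support of `μ`
near a given point. With `E = R^(5ε/(2β))` it shows that at most half of `R^(β-ε)` centres lie
within `G/(2E)` of `t/q`. It also shows that any subset with more than `R^(β-ε)/2` centres has two
at distance at most `E m s` with different lines (`PowerLaw.exists_close_pair`). Applied to the
centres far from `t/q`, this gives two distinct lines with close ordinates, both away from `t/q`.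

Contradiction. Two distinct lines through a point of denominator `q` have a cross product divisible
by `q`, so close ordinates force `q |θ - p/q|` to be small, while an ordinate away from `t/q` keeps
`|θ - p/q|` from being too small. Together these bound `q` (`denominator_bounds`). The pigeonhole
principle then gives a line `M` through the point with `|A| ≤ q^i` and `B ≤ q^j`; bad
approximability of `θ` excludes `B = 0`. So `H(M) ≤ q^(1+j) < R^(n-l-1)`, and one of the two centres
lies in `Δ(M)` (`Params.exists_low_line`). But `J` was kept in generation `n-l` and therefore misses
`Δ(M)`. -/

namespace PowerLaw

/-! ### Counting separated points with a power law -/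

lemma le_real_closedBall {X : Type*} [PseudoMetricSpace X] [MeasurableSpace X] {μ : Measure X}
    [IsFiniteMeasure μ] {β b₁ b₂ : ℝ} (h : PowerLaw μ β b₁ b₂) {x : X} (hx : x ∈ μ.support)
    {r : ℝ} (hr : 0 < r) (hr' : r < 1) : b₁ * r ^ β ≤ μ.real (Metric.closedBall x r) :=
  (ENNReal.ofReal_le_iff_le_toReal (measure_ne_top _ _)).1 (h.2.2.2 x hx r hr hr').1

lemma real_closedBall_le {X : Type*} [PseudoMetricSpace X] [MeasurableSpace X] {μ : Measure X}
    {β b₁ b₂ : ℝ} (h : PowerLaw μ β b₁ b₂) {x : X} (hx : x ∈ μ.support)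
    {r : ℝ} (hr : 0 < r) (hr' : r < 1) : μ.real (Metric.closedBall x r) ≤ b₂ * r ^ β :=
  ENNReal.toReal_le_of_le_ofReal (mul_nonneg h.2.2.1.le (Real.rpow_nonneg hr.le _))
    (h.2.2.2 x hx r hr hr').2

/-- The number of pairwise disjoint balls of radius `r` with centres in the support and near a
fixed point of the support. -/
lemma card_le {X : Type*} [PseudoMetricSpace X] [MeasurableSpace X] [OpensMeasurableSpace X]
    {μ : Measure X} [IsFiniteMeasure μ] {β b₁ b₂ : ℝ} (h : PowerLaw μ β b₁ b₂) {Z : Finset X}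
    {r D : ℝ} (hr : 0 < r) (hD : 0 ≤ D) (hrD : D + r < 1) (hZ : ∀ z ∈ Z, z ∈ μ.support)
    (hdisj : (Z : Set X).PairwiseDisjoint (fun z => Metric.closedBall z r))
    (hdist : ∀ z ∈ Z, ∀ z' ∈ Z, dist z z' ≤ D) :
    (Z.card : ℝ) ≤ b₂ / b₁ * ((D + r) / r) ^ β := by
  obtain ⟨hβ, hb₁, hb₂, -⟩ := id h
  rcases Z.eq_empty_or_nonempty with rfl | ⟨z₀, hz₀⟩
  · simp only [Finset.card_empty, Nat.cast_zero]; positivity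
  have key : (Z.card : ℝ) * (b₁ * r ^ β) ≤ b₂ * (D + r) ^ β := by
    calc (Z.card : ℝ) * (b₁ * r ^ β) = ∑ z ∈ Z, b₁ * r ^ β := by simp
      _ ≤ ∑ z ∈ Z, μ.real (Metric.closedBall z r) :=
          Finset.sum_le_sum fun z hz => h.le_real_closedBall (hZ z hz) hr (by linarith)
      _ = μ.real (⋃ z ∈ Z, Metric.closedBall z r) :=
          (measureReal_biUnion_finset hdisj fun z _ => Metric.isClosed_closedBall.measurableSet).symm
      _ ≤ μ.real (Metric.closedBall z₀ (D + r)) := by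
          refine measureReal_mono (Set.iUnion₂_subset fun z hz => ?_)
          exact Metric.closedBall_subset_closedBall' (by linarith [hdist z hz z₀ hz₀])
      _ ≤ _ := h.real_closedBall_le (hZ z₀ hz₀) (by linarith) hrD
  rw [Real.div_rpow (by linarith) hr.le, div_mul_div_comm, le_div_iff₀ (by positivity)]
  exact key

lemma lower_le_upper {X : Type*} [PseudoMetricSpace X] [MeasurableSpace X] {μ : Measure X}
    [IsFiniteMeasure μ] {β b₁ b₂ : ℝ} (h : PowerLaw μ β b₁ b₂) (hne : μ.support.Nonempty) :
    b₁ ≤ b₂ := by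
  obtain ⟨x, hx⟩ := hne
  have := (h.le_real_closedBall hx one_half_pos one_half_lt_one).trans
    (h.real_closedBall_le hx one_half_pos one_half_lt_one)
  exact le_of_mul_le_mul_right this (by positivity)

/-- A measure on the unit interval cannot satisfy a power law with exponent larger than `1`. -/
lemma exponent_le_one {μ : Measure ℝ} [IsProbabilityMeasure μ] {β b₁ b₂ : ℝ}
    (h : PowerLaw μ β b₁ b₂) (hsupp : μ.support ⊆ Set.Icc (0 : ℝ) 1) : β ≤ 1 := by
  by_contra! hβ
  have hb₂ := h.2.2.1
  have hlim : Filter.Tendsto (fun n : ℕ => ((n : ℝ)) ^ (β - 1)) Filter.atTop Filter.atTop :=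
    (tendsto_rpow_atTop (by linarith)).comp tendsto_natCast_atTop_atTop
  -- About `N` intervals of length `1/N`, each of mass at most `b₂ N^(-β)`, carry the total mass
  -- `1`. For `β > 1` this fails once `N^(β-1) > 2 b₂`.
  obtain ⟨N, hN, hN2⟩ := ((hlim.eventually_gt_atTop (2 * b₂)).and
    (Filter.eventually_ge_atTop 2)).exists
  have hN0 : (0 : ℝ) < N := by positivity
  have hN2' : (2 : ℝ) ≤ N := by exact_mod_cast hN2
  let I : ℕ → Set ℝ := fun k => Set.Icc ((k : ℝ) / N) ((k + 1 : ℝ) / N)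
  have hI : ∀ k, μ.real (I k) ≤ b₂ * (1 / N : ℝ) ^ β := by
    intro k
    by_cases hk : (I k ∩ μ.support).Nonempty
    · obtain ⟨x, hx, hxs⟩ := hk
      refine (measureReal_mono ?_).trans (h.real_closedBall_le hxs (by positivity)
        (by rw [div_lt_one hN0]; linarith))
      intro y hy
      simp only [I, Set.mem_Icc] at hx hy
      rw [add_div] at hx hy
      rw [Real.closedBall_eq_Icc]
      constructor <;> linarith [hx.1, hx.2, hy.1, hy.2]
    · have : μ (I k) = 0 := by
        by_contra hne
        exact hk (Measure.nonempty_inter_support_of_pos (pos_iff_ne_zero.2 hne))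
      rw [measureReal_def, this]
      simp only [ENNReal.toReal_zero]; positivity
  -- There are `N + 1` intervals because `x = 1` is assigned the index `N`.
  have hcover : μ.support ⊆ ⋃ k ∈ Finset.range (N + 1), I k := by
    intro x hx
    have hx01 := hsupp hx
    have hxN : 0 ≤ x * N := mul_nonneg hx01.1 hN0.le
    simp only [Set.mem_iUnion, Finset.mem_range]
    refine ⟨⌊x * N⌋₊, ?_, ?_, ?_⟩
    · have : ⌊x * N⌋₊ ≤ N := Nat.floor_le_of_le (by nlinarith [hx01.2])
      omega
    · rw [div_le_iff₀ hN0]; exact Nat.floor_le hxN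
    · rw [le_div_iff₀ hN0]; exact (Nat.lt_floor_add_one _).le
  have h1 : (1 : ℝ) = μ.real μ.support := by
    have := prob_compl_eq_zero_iff₀ (μ := μ) Measure.nullMeasurableSet_support
    rw [measureReal_def, this.1 Measure.measure_compl_support, ENNReal.toReal_one]
  have h2 : (1 : ℝ) ≤ (N + 1) * (b₂ * (1 / N : ℝ) ^ β) := by
    calc (1 : ℝ) ≤ μ.real (⋃ k ∈ Finset.range (N + 1), I k) := by
          rw [h1]; exact measureReal_mono hcover (measure_ne_top _ _)
      _ ≤ ∑ k ∈ Finset.range (N + 1), μ.real (I k) := measureReal_biUnion_finset_le _ _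
      _ ≤ ∑ k ∈ Finset.range (N + 1), b₂ * (1 / N : ℝ) ^ β := Finset.sum_le_sum fun k _ => hI k
      _ = _ := by simp
  have h3 : (1 / N : ℝ) ^ β * ((N : ℝ) ^ (β - 1) * N) = 1 := by
    rw [← Real.rpow_add_one hN0.ne', sub_add_cancel, ← Real.mul_rpow (by positivity) hN0.le,
      one_div_mul_cancel hN0.ne', Real.one_rpow]
  have h4 : (0 : ℝ) < (1 / N : ℝ) ^ β := by positivity
  have h5 : (N + 1) * (b₂ * (1 / N : ℝ) ^ β) ≤ (2 * b₂) * N * (1 / N : ℝ) ^ β := by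
    have : (N + 1 : ℝ) * b₂ ≤ 2 * b₂ * N := by nlinarith
    nlinarith
  have h6 : (2 * b₂) * N * (1 / N : ℝ) ^ β < 1 := by
    rw [← h3]
    have : 2 * b₂ * N < (N : ℝ) ^ (β - 1) * N := by gcongr
    nlinarith
  linarith

/-- If a labelled set of centres is large, then it has two points that are close to each other and
carry different labels, provided that points with the same label are close. -/
lemma exists_close_pair {X ι : Type*} [MetricSpace X] [MeasurableSpace X] [OpensMeasurableSpace X]
    {μ : Measure X} [IsFiniteMeasure μ] {β b₁ b₂ : ℝ} (h : PowerLaw μ β b₁ b₂) {Z : Finset X}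
    {r s d η : ℝ} (hr : 0 < r) (hd : 0 ≤ d) (hrd : d + r < 1) (hη : 0 < η) (hs : 0 ≤ s)
    (hsη : s + η / 3 < 1) (hZ : ∀ z ∈ Z, z ∈ μ.support)
    (hdisj : (Z : Set X).PairwiseDisjoint (fun z => Metric.closedBall z r))
    (hdist : ∀ z ∈ Z, ∀ z' ∈ Z, dist z z' ≤ s) (f : X → ι)
    (hf : ∀ z ∈ Z, ∀ z' ∈ Z, f z = f z' → dist z z' ≤ d)
    (hcard : b₂ / b₁ * ((d + r) / r) ^ β * (b₂ / b₁ * ((s + η / 3) / (η / 3)) ^ β) < Z.card) :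
    ∃ z ∈ Z, ∃ z' ∈ Z, f z ≠ f z' ∧ dist z z' ≤ η := by
  classical
  by_contra! hcon
  refine hcard.not_ge ?_
  have hb₁ := h.2.1
  have hb₂ := h.2.2.1
  have hfib : ∀ y ∈ Z.image f, ((Z.filter (fun z => f z = y)).card : ℝ) ≤
      b₂ / b₁ * ((d + r) / r) ^ β := by
    intro y _
    refine h.card_le hr hd hrd (fun z hz => hZ z (Finset.mem_filter.1 hz).1)
      (hdisj.subset (Finset.coe_subset.2 (Finset.filter_subset _ _))) ?_
    intro z hz z' hz'
    rw [Finset.mem_filter] at hz hz'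
    exact hf z hz.1 z' hz'.1 (hz.2.trans hz'.2.symm)
  have hex : ∀ y ∈ Z.image f, ∃ z ∈ Z, f z = y := fun y hy => Finset.mem_image.1 hy
  obtain ⟨g, hg'⟩ : ∃ g : ι → X, ∀ y ∈ Z.image f, g y ∈ Z ∧ f (g y) = y := by
    obtain ⟨z₀, -⟩ : Z.Nonempty :=
      Finset.card_pos.1 (Nat.cast_pos.1 ((by positivity : (0 : ℝ) ≤ _).trans_lt hcard))
    have : Nonempty X := ⟨z₀⟩
    choose! g hg' using hex
    exact ⟨g, hg'⟩
  have hgZ := fun y hy => (hg' y hy).1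
  have hg := fun y hy => (hg' y hy).2
  -- One representative per label: by `hcon` these are more than `η` apart, so their balls of radius
  -- `η/3` are disjoint and `card_le` applies.
  have himg : ((Z.image f).card : ℝ) ≤ b₂ / b₁ * ((s + η / 3) / (η / 3)) ^ β := by
    have hinj : Set.InjOn g (Z.image f) := fun y hy y' hy' e => by
      rw [← hg y hy, ← hg y' hy', e]
    rw [← Finset.card_image_of_injOn hinj]
    have hsub : ∀ z ∈ (Z.image f).image g, z ∈ Z := by
      intro z hz
      obtain ⟨y, hy, rfl⟩ := Finset.mem_image.1 hz
      exact hgZ y hy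
    refine h.card_le (by positivity) hs hsη (fun z hz => hZ z (hsub z hz)) ?_
      (fun z hz z' hz' => hdist z (hsub z hz) z' (hsub z' hz'))
    intro z hz z' hz' hne
    obtain ⟨y, hy, rfl⟩ := Finset.mem_image.1 hz
    obtain ⟨y', hy', rfl⟩ := Finset.mem_image.1 hz'
    have hyy : f (g y) ≠ f (g y') := by
      rw [hg y hy, hg y' hy']; rintro rfl; exact hne rfl
    have := hcon _ (hgZ y hy) _ (hgZ y' hy') hyy
    exact Metric.closedBall_disjoint_closedBall (by linarith)
  calc (Z.card : ℝ) = ∑ y ∈ Z.image f, ((Z.filter (fun z => f z = y)).card : ℝ) := by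
        rw [Finset.card_eq_sum_card_image f Z]; push_cast; rfl
    _ ≤ ∑ y ∈ Z.image f, b₂ / b₁ * ((d + r) / r) ^ β := Finset.sum_le_sum hfib
    _ = (Z.image f).card * (b₂ / b₁ * ((d + r) / r) ^ β) := by simp
    _ ≤ b₂ / b₁ * ((s + η / 3) / (η / 3)) ^ β * (b₂ / b₁ * ((d + r) / r) ^ β) := by gcongr
    _ = _ := mul_comm _ _

end PowerLaw

/-! ### Nesting and disjointness of the intervals -/

namespace Params

variable {P : Params}

lemma c₁_pos (hθ : IsBadConstant P.i P.θ P.cθ) (hR : 0 < P.R) : 0 < P.c₁ := by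
  have : (0 : ℝ) < P.R := by exact_mod_cast hR
  exact lt_min (mul_pos hθ.1 (by positivity)) (by positivity)

lemma radius_pos (hc₁ : 0 < P.c₁) (hR : 0 < P.R) (n : ℕ) : 0 < P.radius n := by
  have : (0 : ℝ) < P.R := by exact_mod_cast hR
  unfold radius; positivity

/-- The margin left by `I⁻` is `R^(-α)` times the radius; the next radius is only `R^(-1)` times it,
and `α ≤ 1`. -/
lemma interval_subset_of_mem_shrunk (hc₁ : 0 < P.c₁) (hR : 0 < P.R) (hα : P.α ≤ 1) {n : ℕ}
    {y z : ℝ} (hz : z ∈ P.shrunk n y) : P.interval (n + 1) z ⊆ P.interval n y := by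
  have hR0 : (0 : ℝ) < P.R := by exact_mod_cast hR
  have hR1 : (1 : ℝ) ≤ P.R := by exact_mod_cast hR
  refine Metric.closedBall_subset_closedBall' ?_
  have h1 : P.radius (n + 1) = P.radius n * (P.R : ℝ) ^ (-1 : ℝ) := by
    unfold radius
    rw [mul_assoc _ _ ((P.R : ℝ) ^ (-1 : ℝ)), ← Real.rpow_add hR0]; push_cast; ring_nf
  have h2 : (P.R : ℝ) ^ (-1 : ℝ) ≤ (P.R : ℝ) ^ (-P.α) :=
    Real.rpow_le_rpow_of_exponent_le hR1 (by linarith)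
  have h3 := Metric.mem_closedBall.1 hz
  have h4 := mul_le_mul_of_nonneg_left h2 (radius_pos hc₁ hR n).le
  rw [h1]; linarith

end Params

namespace Choices

variable {T : Choices} {P : Params} {μ : Measure ℝ}

lemma I_subset_support (hT : T.IsAdmissible P μ) : ∀ n, T.I n ⊆ μ.support
  | 0 => hT.1.1
  | n + 1 => by
    intro z hz
    obtain ⟨y, hy, hz⟩ := Set.mem_iUnion₂.1 hz
    exact ((hT.2 n y hy).1 hz).1

lemma J_subset_I : ∀ n, T.J P n ⊆ T.I n
  | 0 => subset_rfl
  | n + 1 => fun _ hz => Set.biUnion_subset_biUnion_left (J_subset_I n) hz.1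

lemma interval_subset_of_mem_child (hT : T.IsAdmissible P μ) (hc₁ : 0 < P.c₁) (hR : 0 < P.R)
    (hα : P.α ≤ 1) {n : ℕ} {y z : ℝ} (hy : y ∈ T.I n) (hz : z ∈ T.child n y) :
    P.interval (n + 1) z ⊆ P.interval n y :=
  Params.interval_subset_of_mem_shrunk hc₁ hR hα ((hT.2 n y hy).1 hz).2

lemma pairwiseDisjoint_I (hT : T.IsAdmissible P μ) (hc₁ : 0 < P.c₁) (hR : 0 < P.R)
    (hα : P.α ≤ 1) : ∀ n, (T.I n).PairwiseDisjoint (P.interval n)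
  | 0 => hT.1.2.1
  | n + 1 => by
    intro z hz z' hz' hne
    obtain ⟨y, hy, hzy⟩ := Set.mem_iUnion₂.1 hz
    obtain ⟨y', hy', hzy'⟩ := Set.mem_iUnion₂.1 hz'
    by_cases e : y = y'
    · subst e
      exact (hT.2 n y hy).2.1 hzy hzy' hne
    · exact (pairwiseDisjoint_I hT hc₁ hR hα n hy hy' e).mono
        (interval_subset_of_mem_child hT hc₁ hR hα hy hzy)
        (interval_subset_of_mem_child hT hc₁ hR hα hy' hzy')

lemma exists_ancestor (hT : T.IsAdmissible P μ) (hc₁ : 0 < P.c₁) (hR : 0 < P.R)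
    (hα : P.α ≤ 1) {m n : ℕ} (hmn : m ≤ n) {y : ℝ} (hy : y ∈ T.J P n) :
    ∃ y' ∈ T.J P m, P.interval n y ⊆ P.interval m y' := by
  induction n, hmn using Nat.le_induction generalizing y with
  | base => exact ⟨y, hy, subset_rfl⟩
  | succ n _ ih =>
    obtain ⟨x, hx, hyx⟩ := Set.mem_iUnion₂.1 hy.1
    obtain ⟨y', hy', hsub⟩ := ih hx
    exact ⟨y', hy', (interval_subset_of_mem_child hT hc₁ hR hα (J_subset_I n hx) hyx).trans hsub⟩

/-- The strips of `C(m)` are removed on passing to generation `m + 1`, so the ancestor of that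
generation already misses `Δ(L)`. The final contradiction is with this fact. -/
lemma disjoint_Δ_of_mem_J (hT : T.IsAdmissible P μ) (hc₁ : 0 < P.c₁) (hR : 0 < P.R)
    (hα : P.α ≤ 1) {m n : ℕ} (hmn : m < n) {y : ℝ} (hy : y ∈ T.J P n) {L : Line}
    (hL : L ∈ P.linesAt m) : Disjoint (P.Δ L) (P.interval n y) := by
  obtain ⟨y', hy', hsub⟩ := exists_ancestor hT hc₁ hR hα hmn hy
  exact (Set.disjoint_iff_inter_eq_empty.2 (hy'.2 L hL)).mono_right hsub

end Choices

/-! ### Primitive integer triples and lines through rational points -/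

lemma Int.dvd_of_dvd_mul_of_gcd_gcd_eq_one {x y z d k : ℤ}
    (h : Int.gcd (Int.gcd x y) z = 1) (hx : d ∣ x * k) (hy : d ∣ y * k) (hz : d ∣ z * k) :
    d ∣ k := by
  have h1 : d ∣ ((Int.gcd x y : ℕ) : ℤ) * k := by
    have := Int.dvd_coe_gcd hx hy
    rw [Int.gcd_mul_right] at this
    push_cast at this
    rwa [← dvd_abs, abs_mul, Nat.abs_cast]
  have h2 := Int.dvd_coe_gcd h1 hz
  rw [Int.gcd_mul_right, h] at h2
  simpa using h2

lemma Int.exists_primitive_triple {x y z : ℤ} (h : x ≠ 0 ∨ y ≠ 0 ∨ z ≠ 0) :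
    ∃ g x' y' z' : ℤ, 0 < g ∧ x = g * x' ∧ y = g * y' ∧ z = g * z' ∧
      Int.gcd (Int.gcd x' y') z' = 1 := by
  set g : ℕ := Int.gcd (Int.gcd x y) z with hg
  have hgx : (g : ℤ) ∣ x := (Int.gcd_dvd_left ..).trans (Int.gcd_dvd_left ..)
  have hgy : (g : ℤ) ∣ y := (Int.gcd_dvd_left ..).trans (Int.gcd_dvd_right ..)
  have hgz : (g : ℤ) ∣ z := Int.gcd_dvd_right ..
  have hg0 : 0 < g := by
    rw [Nat.pos_iff_ne_zero]
    intro h0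
    rw [h0] at hgx hgy hgz
    simp only [Nat.cast_zero, zero_dvd_iff] at hgx hgy hgz
    tauto
  obtain ⟨x', hx'⟩ := hgx
  obtain ⟨y', hy'⟩ := hgy
  obtain ⟨z', hz'⟩ := hgz
  refine ⟨g, x', y', z', by exact_mod_cast hg0, hx', hy', hz', ?_⟩
  have h1 : g = g * Int.gcd (Int.gcd x' y') z' := by
    conv_lhs => rw [hg, hx', hy', hz', Int.gcd_mul_left, Nat.cast_mul, Int.natAbs_natCast,
      Int.gcd_mul_left, Int.natAbs_natCast]
  exact (Nat.eq_of_mul_eq_mul_left hg0 (by rw [← h1, mul_one])).symm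

/-- Every rational point with denominator `q` lies on a line with small coefficients. -/
lemma exists_line_through (p t : ℤ) {q X Y : ℕ} (hq : 0 < q) (hXY : q < (X + 1) * (Y + 1)) :
    ∃ L : Line, Int.gcd (Int.gcd L.A L.B) L.C = 1 ∧ |L.A| ≤ X ∧ 0 ≤ L.B ∧ L.B ≤ Y ∧
      (L.A ≠ 0 ∨ L.B ≠ 0) ∧ L.A * p - L.B * t + L.C * q = 0 := by
  classical
  have : NeZero q := ⟨hq.ne'⟩
  let S := Finset.range (X + 1) ×ˢ Finset.range (Y + 1)
  have hcard : (Finset.univ : Finset (ZMod q)).card < S.card := by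
    simpa [S, ZMod.card] using hXY
  -- Pigeonhole on the residues of `a p - b t` modulo `q`; the difference of two colliding pairs
  -- gives the line, and the quotient by `q` gives its third coefficient.
  obtain ⟨u, hu, v, hv, huv, he⟩ := Finset.exists_ne_map_eq_of_card_lt_of_maps_to hcard
    (f := fun u => ((u.1 * p - u.2 * t : ℤ) : ZMod q)) (fun _ _ => Finset.mem_coe.2 (Finset.mem_univ _))
  simp only [S, Finset.mem_product, Finset.mem_range] at hu hv
  have hne : ∃ a b c : ℤ, |a| ≤ X ∧ 0 ≤ b ∧ b ≤ Y ∧ (a ≠ 0 ∨ b ≠ 0) ∧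
      a * p - b * t + c * q = 0 := by
    wlog hle : v.2 ≤ u.2 generalizing u v
    · exact this v u huv.symm he.symm hv hu (by omega)
    obtain ⟨c, hc⟩ := (ZMod.intCast_eq_intCast_iff_dvd_sub _ _ _).1 he
    refine ⟨u.1 - v.1, u.2 - v.2, c, ?_, by omega, by omega, ?_, by linarith⟩
    · rw [abs_le]; omega
    · by_contra! h
      exact huv (Prod.ext (by omega) (by omega))
  obtain ⟨a, b, c, ha, hb0, hb, hab, hrel⟩ := hne
  obtain ⟨g, a', b', c', hg, rfl, rfl, rfl, hprim⟩ :=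
    Int.exists_primitive_triple (x := a) (y := b) (z := c) (by tauto)
  refine ⟨⟨a', b', c'⟩, hprim, ?_, ?_, ?_, ?_, ?_⟩
  · rw [abs_mul, abs_of_pos hg] at ha
    nlinarith [abs_nonneg a']
  · exact nonneg_of_mul_nonneg_right hb0 hg
  · have := nonneg_of_mul_nonneg_right hb0 hg
    change b' ≤ Y
    nlinarith
  · simpa [hg.ne'] using hab
  · have : g * (a' * p - b' * t + c' * q) = 0 := by linear_combination hrel
    exact (mul_eq_zero.1 this).resolve_left hg.ne'

/-! ### Concurrency and intersection of lines -/

/-- As the coefficients sum to zero, the middle one of `x`, `y`, `z` can be subtracted from all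
three. The other two lie on opposite sides of it, at distances adding up to at most `σ`. Subtracting
an arbitrary one would give only `2Kσ`, too weak for `Params.exists_common_point`. -/
lemma abs_sum_mul_le_of_sum_eq_zero {a b c x y z K σ : ℝ} (h : a + b + c = 0) (ha : |a| ≤ K)
    (hb : |b| ≤ K) (hc : |c| ≤ K) (hxy : |x - y| ≤ σ) (hyz : |y - z| ≤ σ) (hxz : |x - z| ≤ σ) :
    |a * x + b * y + c * z| ≤ K * σ := by
  have hK : 0 ≤ K := (abs_nonneg a).trans ha
  have key : ∀ {u v p q m : ℝ}, |u| ≤ K → |v| ≤ K → p ≤ m → m ≤ q → |p - q| ≤ σ →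
      |u * (p - m) + v * (q - m)| ≤ K * σ := by
    intro u v p q m hu hv hp hq hpq
    calc |u * (p - m) + v * (q - m)| ≤ |u * (p - m)| + |v * (q - m)| := abs_add_le _ _
      _ = |u| * (m - p) + |v| * (q - m) := by
          rw [abs_mul, abs_mul, abs_of_nonpos (sub_nonpos.2 hp), abs_of_nonneg (sub_nonneg.2 hq)]
          ring
      _ ≤ K * (m - p) + K * (q - m) := by
          gcongr
      _ = K * (q - p) := by ring
      _ ≤ K * σ := by
          gcongr
          exact (le_abs_self _).trans ((abs_sub_comm q p).trans_le hpq)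
  have e1 : a * x + b * y + c * z = b * (y - x) + c * (z - x) := by linear_combination h * x
  have e2 : a * x + b * y + c * z = a * (x - y) + c * (z - y) := by linear_combination h * y
  have e3 : a * x + b * y + c * z = a * (x - z) + b * (y - z) := by linear_combination h * z
  rw [abs_sub_comm] at hxy hyz hxz
  rcases le_total x y with h1 | h1 <;> rcases le_total y z with h2 | h2 <;>
    rcases le_total x z with h3 | h3
  · rw [e2]; exact key ha hc h1 h2 (by rwa [abs_sub_comm])
  · rw [e2]; exact key ha hc h1 h2 (by rwa [abs_sub_comm])
  · rw [e3]; exact key ha hb h3 h2 (by rwa [abs_sub_comm])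
  · rw [e1, add_comm]; exact key hc hb h3 h1 (by assumption)
  · rw [e1]; exact key hb hc h1 h3 (by rwa [abs_sub_comm])
  · rw [e3, add_comm]; exact key hb ha h2 h3 (by assumption)
  · rw [e2, add_comm]; exact key hc ha h2 h1 (by assumption)
  · rw [e2, add_comm]; exact key hc ha h2 h1 (by assumption)

namespace Line

/-- The ordinate of the intersection of a line with the vertical line of abscissa `θ`. -/
noncomputable def ordinate (θ : ℝ) (L : Line) : ℝ := (L.A * θ + L.C) / L.B

/-- The coefficients are coprime and the coefficient `B` is positive. -/
def IsNormalized (L : Line) : Prop := Int.gcd (Int.gcd L.A L.B) L.C = 1 ∧ 0 < L.B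

lemma IsNormalized.B_pos {L : Line} (h : L.IsNormalized) : (0 : ℝ) < L.B := by
  exact_mod_cast h.2

lemma IsNormalized.C_eq {L : Line} (h : L.IsNormalized) (θ : ℝ) :
    (L.C : ℝ) = L.B * L.ordinate θ - L.A * θ := by
  have := h.B_pos
  unfold ordinate; field_simp; ring

/-- Primitivity of each triple makes `B` and `B'` divide each other, and both are positive. -/
lemma IsNormalized.eq_of_proportional {L L' : Line} (h : L.IsNormalized) (h' : L'.IsNormalized)
    (hA : L.A * L'.B = L'.A * L.B) (hC : L.C * L'.B = L'.C * L.B) : L = L' := by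
  have h1 : L'.B ∣ L.B := Int.dvd_of_dvd_mul_of_gcd_gcd_eq_one h'.1 (Dvd.intro_left _ hA)
    (dvd_mul_right _ _) (Dvd.intro_left _ hC)
  have h2 : L.B ∣ L'.B := Int.dvd_of_dvd_mul_of_gcd_gcd_eq_one h.1 (Dvd.intro_left _ hA.symm)
    (dvd_mul_right _ _) (Dvd.intro_left _ hC.symm)
  have hB : L.B = L'.B := le_antisymm (Int.le_of_dvd h'.2 h2) (Int.le_of_dvd h.2 h1)
  have hB0 : L'.B ≠ 0 := h'.2.ne'
  rw [hB] at hA hC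
  obtain ⟨A, B, C⟩ := L
  obtain ⟨A', B', C'⟩ := L'
  simp only [mk.injEq]
  exact ⟨mul_right_cancel₀ hB0 hA, hB, mul_right_cancel₀ hB0 hC⟩

/-- Distinct parallel lines are far from each other. -/
lemma IsNormalized.not_parallel {L L' : Line} (h : L.IsNormalized) (h' : L'.IsNormalized)
    (hne : L ≠ L') {θ b σ : ℝ} (hb : (L.B : ℝ) ≤ b) (hb' : (L'.B : ℝ) ≤ b)
    (hσ : |L.ordinate θ - L'.ordinate θ| ≤ σ) (hbσ : b ^ 2 * σ < 1) :
    L.A * L'.B ≠ L'.A * L.B := by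
  intro hA
  refine hne (h.eq_of_proportional h' hA ?_)
  have hB := h.B_pos
  have hB' := h'.B_pos
  have hA' : (L.A : ℝ) * L'.B = L'.A * L.B := by exact_mod_cast hA
  have e : ((L.C * L'.B - L'.C * L.B : ℤ) : ℝ) =
      L.B * L'.B * (L.ordinate θ - L'.ordinate θ) := by
    push_cast
    rw [h.C_eq θ, h'.C_eq θ]
    linear_combination (-θ) * hA'
  have h1 : |((L.C * L'.B - L'.C * L.B : ℤ) : ℝ)| < 1 := by
    rw [e, abs_mul, abs_of_pos (mul_pos hB hB')]
    refine lt_of_le_of_lt ?_ hbσ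
    have : 0 ≤ b := hB.le.trans hb
    rw [sq]; gcongr
  have h2 : |L.C * L'.B - L'.C * L.B| < 1 := by exact_mod_cast h1
  exact sub_eq_zero.1 (Int.abs_lt_one_iff.1 h2)

/-- Three lines that meet a short vertical segment are concurrent or parallel. -/
lemma det_eq_zero {L₁ L₂ L₃ : Line} (h₁ : L₁.IsNormalized) (h₂ : L₂.IsNormalized)
    (h₃ : L₃.IsNormalized) {θ a b σ : ℝ}
    (hA₁ : |(L₁.A : ℝ)| ≤ a) (hA₂ : |(L₂.A : ℝ)| ≤ a) (hA₃ : |(L₃.A : ℝ)| ≤ a)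
    (hB₁ : (L₁.B : ℝ) ≤ b) (hB₂ : (L₂.B : ℝ) ≤ b) (hB₃ : (L₃.B : ℝ) ≤ b)
    (h₁₂ : |L₁.ordinate θ - L₂.ordinate θ| ≤ σ) (h₂₃ : |L₂.ordinate θ - L₃.ordinate θ| ≤ σ)
    (h₁₃ : |L₁.ordinate θ - L₃.ordinate θ| ≤ σ) (hσ : 2 * a * b ^ 2 * σ < 1) :
    L₃.A * (L₁.C * L₂.B - L₁.B * L₂.C) - L₃.B * (L₁.C * L₂.A - L₁.A * L₂.C) +
      L₃.C * (L₂.A * L₁.B - L₁.A * L₂.B) = 0 := by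
  have ha : 0 ≤ a := (abs_nonneg _).trans hA₁
  have hb : 0 ≤ b := h₁.B_pos.le.trans hB₁
  have bound : ∀ {L M N : Line}, L.IsNormalized → M.IsNormalized → N.IsNormalized →
      |(L.A : ℝ)| ≤ a → |(M.A : ℝ)| ≤ a → (L.B : ℝ) ≤ b → (M.B : ℝ) ≤ b → (N.B : ℝ) ≤ b →
      |(N.B : ℝ) * (L.A * M.B - M.A * L.B)| ≤ 2 * a * b ^ 2 := by
    intro L M N hL hM hN hLA hMA hLB hMB hNB
    have := hL.B_pos
    have := hM.B_pos
    have := hN.B_pos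
    calc |(N.B : ℝ) * (L.A * M.B - M.A * L.B)|
        ≤ (N.B : ℝ) * (|(L.A : ℝ)| * M.B + |(M.A : ℝ)| * L.B) := by
          rw [abs_mul, abs_of_pos hN.B_pos]
          gcongr
          refine (abs_sub _ _).trans_eq ?_
          rw [abs_mul, abs_mul, abs_of_pos hL.B_pos, abs_of_pos hM.B_pos]
      _ ≤ b * (a * b + a * b) := by gcongr
      _ = _ := by ring
  -- Substituting `C = B · ordinate - A θ` cancels `θ` from the determinant. A combination of the
  -- three ordinates remains, whose coefficients, each a `B` times a cross product, sum to zero.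
  have key := abs_sum_mul_le_of_sum_eq_zero (by ring)
    (bound h₃ h₂ h₁ hA₃ hA₂ hB₃ hB₂ hB₁) (bound h₁ h₃ h₂ hA₁ hA₃ hB₁ hB₃ hB₂)
    (bound h₂ h₁ h₃ hA₂ hA₁ hB₂ hB₁ hB₃) h₁₂ h₂₃ h₁₃
  rw [← Int.abs_lt_one_iff]
  have : |((L₃.A * (L₁.C * L₂.B - L₁.B * L₂.C) - L₃.B * (L₁.C * L₂.A - L₁.A * L₂.C) +
      L₃.C * (L₂.A * L₁.B - L₁.A * L₂.B) : ℤ) : ℝ)| < 1 := by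
    refine lt_of_le_of_lt (le_trans (le_of_eq ?_) key) hσ
    congr 1
    push_cast
    rw [h₁.C_eq θ, h₂.C_eq θ, h₃.C_eq θ]
    ring
  exact_mod_cast this

/-- Two distinct lines through a rational point with denominator `q`. -/
lemma exists_cross_eq {L L' : Line} (h : L.IsNormalized) (h' : L'.IsNormalized) (hne : L ≠ L')
    {p t q : ℤ} (hq : q ≠ 0) (hprim : Int.gcd (Int.gcd p t) q = 1)
    (hL : L.A * p - L.B * t + L.C * q = 0) (hL' : L'.A * p - L'.B * t + L'.C * q = 0) :
    L.A * L'.B - L'.A * L.B ≠ 0 ∧ q ∣ L.A * L'.B - L'.A * L.B := by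
  constructor
  · intro h0
    refine hne (h.eq_of_proportional h' (sub_eq_zero.1 h0) ?_)
    have : q * (L.C * L'.B - L'.C * L.B) = 0 := by
      linear_combination hL * L'.B - hL' * L.B - p * h0
    exact sub_eq_zero.1 ((mul_eq_zero.1 this).resolve_left hq)
  -- Eliminating `t` or `p` between the two incidence relations makes the cross product times `p`,
  -- or times `t`, a multiple of `q`.
  · refine Int.dvd_of_dvd_mul_of_gcd_gcd_eq_one hprim ?_ ?_ (dvd_mul_right _ _)
    · exact ⟨L'.C * L.B - L.C * L'.B, by linear_combination hL * L'.B - hL' * L.B⟩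
    · exact ⟨L'.C * L.A - L.C * L'.A, by linear_combination hL * L'.A - hL' * L.A⟩

/-- The intersection of two lines that are not parallel, as a primitive integer vector. -/
lemma exists_intersection {L L' : Line} (hne : L.A * L'.B ≠ L'.A * L.B) :
    ∃ (p t : ℤ) (q : ℕ), 0 < q ∧ Int.gcd (Int.gcd p t) q = 1 ∧
      ∀ M : Line, M.A * (L.C * L'.B - L.B * L'.C) - M.B * (L.C * L'.A - L.A * L'.C) +
        M.C * (L'.A * L.B - L.A * L'.B) = 0 → M.A * p - M.B * t + M.C * q = 0 := by
  have h0 : L'.A * L.B - L.A * L'.B ≠ 0 := sub_ne_zero.2 hne.symm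
  obtain ⟨g, p, t, q, hg, hp, ht, hq, hprim⟩ := Int.exists_primitive_triple
    (x := L.C * L'.B - L.B * L'.C) (y := L.C * L'.A - L.A * L'.C)
    (z := L'.A * L.B - L.A * L'.B) (by tauto)
  have hrel : ∀ M : Line, M.A * (L.C * L'.B - L.B * L'.C) - M.B * (L.C * L'.A - L.A * L'.C) +
        M.C * (L'.A * L.B - L.A * L'.B) = 0 → M.A * p - M.B * t + M.C * q = 0 := by
    intro M hM
    rw [hp, ht, hq] at hM
    have : g * (M.A * p - M.B * t + M.C * q) = 0 := by linear_combination hM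
    exact (mul_eq_zero.1 this).resolve_left hg.ne'
  have hq0 : q ≠ 0 := by rintro rfl; exact h0 (by rw [hq, mul_zero])
  rcases lt_or_gt_of_ne hq0 with hneg | hpos
  · lift -q to ℕ using by omega with k hk
    refine ⟨-p, -t, k, by omega, ?_, fun M hM => ?_⟩
    · rw [hk, Int.gcd_neg, Int.gcd_neg, Int.neg_gcd]; exact hprim
    · rw [hk]; linear_combination -hrel M hM
  · lift q to ℕ using by omega with k hk
    exact ⟨p, t, k, by omega, hprim, hrel⟩

end Line

/-! ### Consequences of the two conditions on `R` -/

section Numerics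

variable {R ε β α ρ x K m E : ℝ}

lemma rpow_gt_of_sum_lt {b₁ b₂ : ℝ} (hR : 1 ≤ R) (hb₁ : 0 < b₁) (hb : b₁ ≤ b₂)
    (h : R ^ (-ε) + R ^ (ε - α * β) < 1 / 2 * (b₁ / (4 * b₂)) ^ 2) :
    32 * (b₂ / b₁) ^ 2 < R ^ ε := by
  have hR0 : 0 < R := by linarith
  have hb₂ : 0 < b₂ := by linarith
  have h1 : R ^ (-ε) < 1 / 2 * (b₁ / (4 * b₂)) ^ 2 := by
    have : 0 < R ^ (ε - α * β) := by positivity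
    linarith
  rw [Real.rpow_neg hR0.le, inv_lt_comm₀ (by positivity) (by positivity)] at h1
  refine lt_of_eq_of_lt ?_ h1
  field_simp
  norm_num

/-- Neither `R > 1` nor `ε > 0` is assumed in the theorem; both are recovered here. -/
lemma one_lt_and_pos_of_rpow_gt (hR : 1 ≤ R) (hρ : 1 ≤ ρ) (h : 32 * ρ ^ 2 < R ^ ε) :
    1 < R ∧ 0 < ε := by
  have h1 : 1 < R ^ ε := by nlinarith
  rcases (Real.one_lt_rpow_iff_of_pos (by linarith)).1 h1 with h | h
  · exact h
  · linarith [h.1]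

/-- The exponent defining `E` makes `E^β = R^(ε/2) R^ε R^ε`. The first factor is at least `5` and
one factor `R^ε` exceeds `32 ρ²`; the other is kept to pay for the gain `R^(-ε)` in the count. -/
lemma rpow_ge_mul_rpow (hR : 1 < R) (hρ : 1 ≤ ρ) (hβ : 0 < β) (h : 32 * ρ ^ 2 < R ^ ε) :
    160 * ρ ^ 2 * R ^ ε ≤ (R ^ (5 * ε / (2 * β))) ^ β := by
  have hR0 : 0 < R := by linarith
  have e : (R ^ (5 * ε / (2 * β))) ^ β = R ^ (ε / 2) * R ^ ε * R ^ ε := by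
    rw [← Real.rpow_mul hR0.le, ← Real.rpow_add hR0, ← Real.rpow_add hR0]
    congr 1
    field_simp; ring
  have h1 : R ^ (ε / 2) * R ^ (ε / 2) = R ^ ε := by rw [← Real.rpow_add hR0]; ring_nf
  have h2 : 0 < R ^ (ε / 2) := by positivity
  have h3 : 5 ≤ R ^ (ε / 2) := by nlinarith
  rw [e]
  have : 160 * ρ ^ 2 ≤ R ^ (ε / 2) * R ^ ε := by nlinarith [sq_nonneg ρ]
  gcongr

/-- This bounds the losses in powers of `E`, for `x = i` and `x = j`. It is the second condition on
`R` raised to the power `x`, compared after raising the claim to the power `β`. The exponents fit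
because `x/α = 4/(β(1-x)) ≥ 4/(1-x)`, by `β ≤ 1`. -/
lemma mul_rpow_le_rpow (hR : 1 < R) (hρ : 1 ≤ ρ) (hε : 0 < ε) (hβ : 0 < β) (hβ1 : β ≤ 1)
    (hx : 0 < x) (hx1 : x < 1) (hα : α = β * x * (1 - x) / 4) (h : 32 * ρ ^ 2 < R ^ ε)
    (h₂ : (4 : ℝ) ^ (2 / (x * (1 - x)) + 2) * ρ < R ^ (α * β - (1 / α + 1) * ε)) :
    96 * (R ^ (5 * ε / (2 * β))) ^ (1 + 2 * x) ≤ R ^ (α * x) := by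
  have hR0 : 0 < R := by linarith
  have hx' : 0 < 1 - x := by linarith
  have hα0 : 0 < α := by rw [hα]; positivity
  have h3 : (16 : ℝ) ≤ (4 ^ (2 / (x * (1 - x)) + 2) * ρ) ^ x := by
    have h4 : (16 : ℝ) ≤ ((4 : ℝ) ^ (2 / (x * (1 - x)) + 2)) ^ x := by
      rw [← Real.rpow_mul (by norm_num)]
      calc (16 : ℝ) = 4 ^ (2 : ℝ) := by norm_num
        _ ≤ _ := by
          refine Real.rpow_le_rpow_of_exponent_le (by norm_num) ?_
          have e : 2 / (x * (1 - x)) * x = 2 / (1 - x) := by field_simp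
          have : 2 ≤ 2 / (1 - x) := by rw [le_div_iff₀ hx']; linarith
          nlinarith
    refine h4.trans (Real.rpow_le_rpow (by positivity) ?_ hx.le)
    exact le_mul_of_one_le_right (by positivity) hρ
  have h5 : (16 : ℝ) ≤ R ^ ((α * β - (1 / α + 1) * ε) * x) := by
    rw [Real.rpow_mul hR0.le]
    exact h3.trans (Real.rpow_le_rpow (by positivity) h₂.le hx.le)
  have h6 : ε * (1 + 5 / 2 * (1 + 2 * x)) ≤ (1 / α + 1) * ε * x := by
    have e : (1 / α + 1) * ε * x = ε * (4 / (β * (1 - x)) + x) := by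
      rw [hα]; field_simp
    rw [e]
    refine mul_le_mul_of_nonneg_left ?_ hε.le
    have h7 : 4 / (1 - x) ≤ 4 / (β * (1 - x)) := by
      gcongr; nlinarith
    have h8 : 1 + 5 / 2 * (1 + 2 * x) ≤ 4 / (1 - x) := by
      rw [le_div_iff₀ hx']; nlinarith [sq_nonneg (x - 3 / 20)]
    linarith
  have h9 : 512 * (R ^ (5 * ε / (2 * β))) ^ (β * (1 + 2 * x)) ≤ R ^ (α * x * β) := by
    calc 512 * (R ^ (5 * ε / (2 * β))) ^ (β * (1 + 2 * x))
        = 16 * (32 * R ^ (ε * (5 / 2 * (1 + 2 * x)))) := by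
          rw [← Real.rpow_mul hR0.le]
          have : 5 * ε / (2 * β) * (β * (1 + 2 * x)) = ε * (5 / 2 * (1 + 2 * x)) := by
            field_simp
          rw [this]; ring
      _ ≤ R ^ ((α * β - (1 / α + 1) * ε) * x) * (R ^ ε * R ^ (ε * (5 / 2 * (1 + 2 * x)))) := by
          gcongr
          nlinarith
      _ ≤ R ^ ((α * β - (1 / α + 1) * ε) * x) * R ^ ((1 / α + 1) * ε * x) := by
          rw [← Real.rpow_add hR0]
          gcongr
          · exact hR.le
          · linarith
      _ = R ^ (α * x * β) := by
          rw [← Real.rpow_add hR0]; ring_nf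
  rw [← Real.rpow_le_rpow_iff (by positivity) (by positivity) hβ,
    ← Real.rpow_mul hR0.le (α * x), Real.mul_rpow (by norm_num) (by positivity),
    ← Real.rpow_mul (by positivity) (1 + 2 * x)]
  refine le_trans ?_ h9
  rw [mul_comm (1 + 2 * x) β]
  gcongr
  calc (96 : ℝ) ^ β ≤ 96 ^ (1 : ℝ) := Real.rpow_le_rpow_of_exponent_le (by norm_num) hβ1
    _ ≤ 512 := by norm_num

/-- Up to powers of `E` the left side is `m^x · mK`. If `m = 1/R`, then `mK ≤ 1` and `2α ≤ x`
suffices. If `m = R^(-α)/K`, then `mK = R^(-α)`, and `m^x ≤ R^(-αx)` pays for the powers of `E`. -/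
lemma rpow_mul_le_rpow_neg (hR : 1 < R) (hα : 0 < α) (hαx : 2 * α ≤ x) (hx1 : x ≤ 1)
    (hK : 1 ≤ K) (hKR : K ≤ R) (hE : 1 ≤ E) (hm : m = max (R⁻¹) (K⁻¹ * R ^ (-α)))
    (h : 96 * E ^ (1 + 2 * x) ≤ R ^ (α * x)) :
    (8 * E ^ 2 * m) ^ x * (2 * E * m) * (2 * K) ≤ R ^ (-α) / 3 := by
  have hR0 : 0 < R := by linarith
  have hK0 : 0 < K := by linarith
  have hE0 : 0 < E := by linarith
  have hx : 0 < x := by linarith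
  have hm0 : 0 < m := by rw [hm]; exact lt_max_of_lt_left (by positivity)
  have e1 : (8 * E ^ 2 * m) ^ x = 8 ^ x * E ^ (2 * x) * m ^ x := by
    rw [Real.mul_rpow (by positivity) hm0.le, Real.mul_rpow (by norm_num) (by positivity),
      Real.rpow_mul hE0.le]
    norm_num
  have e2 : E ^ (1 + 2 * x) = E * E ^ (2 * x) := by
    rw [Real.rpow_add hE0, Real.rpow_one]
  have h8 : (8 : ℝ) ^ x ≤ 8 := by
    calc (8 : ℝ) ^ x ≤ 8 ^ (1 : ℝ) := Real.rpow_le_rpow_of_exponent_le (by norm_num) hx1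
      _ = 8 := by norm_num
  have main : m ^ x * (m * K) * R ^ (α * x) ≤ R ^ (-α) := by
    rcases max_choice (R⁻¹) (K⁻¹ * R ^ (-α)) with h0 | h0
    · rw [h0] at hm
      have h1 : m * K ≤ 1 := by
        rw [hm, inv_mul_le_iff₀ hR0]; linarith
      calc m ^ x * (m * K) * R ^ (α * x) ≤ m ^ x * 1 * R ^ (α * x) := by gcongr
        _ = R ^ (-x + α * x) := by
            rw [Real.rpow_add hR0, hm, Real.inv_rpow hR0.le, Real.rpow_neg hR0.le, mul_one]
        _ ≤ R ^ (-α) := Real.rpow_le_rpow_of_exponent_le hR.le (by nlinarith)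
    · rw [h0] at hm
      have h1 : m * K = R ^ (-α) := by rw [hm]; field_simp
      have h2 : m ≤ R ^ (-α) := by
        rw [← h1]; exact le_mul_of_one_le_right hm0.le hK
      rw [h1]
      calc m ^ x * R ^ (-α) * R ^ (α * x) ≤ (R ^ (-α)) ^ x * R ^ (-α) * R ^ (α * x) := by gcongr
        _ = R ^ (-α) := by
            rw [← Real.rpow_mul hR0.le, ← Real.rpow_add hR0, ← Real.rpow_add hR0]; ring_nf
  calc (8 * E ^ 2 * m) ^ x * (2 * E * m) * (2 * K)
      = 8 ^ x * (4 * E ^ (1 + 2 * x)) * (m ^ x * (m * K)) := by rw [e1, e2]; ring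
    _ ≤ 8 * (R ^ (α * x) / 24) * (m ^ x * (m * K)) := by
        gcongr; linarith
    _ = (m ^ x * (m * K) * R ^ (α * x)) / 3 := by ring
    _ ≤ _ := by gcongr

end Numerics

/-! ### Coefficients of the lines in a class -/

namespace Params

variable {P : Params}

lemma size_pos {L : Line} (hL : 0 < L.B) : 0 < P.size L := by
  have : (0 : ℝ) < L.B := by exact_mod_cast hL
  exact lt_max_of_lt_right (by positivity)

lemma abs_sub_ordinate_le {L : Line} (hL : 0 < L.B) {y : ℝ} (hy : y ∈ P.Δ L) :
    |y - L.ordinate P.θ| ≤ P.c / P.height L := by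
  have hB : (0 : ℝ) < L.B := by exact_mod_cast hL
  have e : (L.A : ℝ) * P.θ - L.B * y + L.C = -(L.B * (y - L.ordinate P.θ)) := by
    unfold Line.ordinate; field_simp; ring
  have h := hy.2
  rw [e, abs_neg, abs_mul, abs_of_pos hB] at h
  have hs := size_pos (P := P) hL
  rw [height, le_div_iff₀ (mul_pos hB hs)]
  rw [le_div_iff₀ hs] at h
  linarith

lemma normalized_of_mem_linesAt {n : ℕ} {L : Line} (hL : L ∈ P.linesAt n) : L.IsNormalized :=
  ⟨hL.1, hL.2.1⟩

lemma abs_A_le (hi : 0 < P.i) {L : Line} (hL : 0 < L.B) {h : ℝ} (hh : P.height L ≤ h) :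
    |(L.A : ℝ)| ≤ (h / L.B) ^ P.i := by
  have hB : (0 : ℝ) < L.B := by exact_mod_cast hL
  have h1 : |(L.A : ℝ)| ^ (1 / P.i) ≤ h / L.B := by
    rw [le_div_iff₀ hB, mul_comm]
    exact (mul_le_mul_of_nonneg_left (le_max_left _ _) hB.le).trans hh
  calc |(L.A : ℝ)| = (|(L.A : ℝ)| ^ (1 / P.i)) ^ P.i := by
        rw [← Real.rpow_mul (abs_nonneg _), one_div_mul_cancel hi.ne', Real.rpow_one]
    _ ≤ _ := Real.rpow_le_rpow (by positivity) h1 hi.le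

lemma B_le (hj : 0 < P.j) {L : Line} (hL : 0 < L.B) {w : ℝ} (hw : 0 < w)
    (hh : P.height L ≤ w ^ (1 + P.j)) : (L.B : ℝ) ≤ w ^ P.j := by
  have hB : (0 : ℝ) < L.B := by exact_mod_cast hL
  have h1 : (L.B : ℝ) ^ (1 + 1 / P.j) ≤ w ^ (1 + P.j) := by
    rw [Real.rpow_add hB, Real.rpow_one]
    refine (mul_le_mul_of_nonneg_left ?_ hB.le).trans hh
    unfold size
    rw [abs_of_pos hB]
    exact le_max_right _ _
  have e1 : (L.B : ℝ) ^ (1 + 1 / P.j) = ((L.B : ℝ) ^ (1 / P.j)) ^ (1 + P.j) := by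
    rw [← Real.rpow_mul hB.le]; congr 1; field_simp; ring
  rw [e1, Real.rpow_le_rpow_iff (by positivity) hw.le (by linarith)] at h1
  calc (L.B : ℝ) = ((L.B : ℝ) ^ (1 / P.j)) ^ P.j := by
        rw [← Real.rpow_mul hB.le, one_div_mul_cancel hj.ne', Real.rpow_one]
    _ ≤ _ := Real.rpow_le_rpow (by positivity) h1 hj.le

/-- The coefficient `B` of a line in `C(n, ℓ, k)`, compared with the height of the line. -/
lemma B_le_of_mem (hj : 0 < P.j) (hj1 : P.j < 1) (hR : 1 < (P.R : ℝ)) {n l k : ℕ} {L : Line}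
    (hL : L ∈ P.linesAtLevelScale n l k) {w : ℝ} (hw : 0 < w)
    (hwh : w ^ (1 + P.j) = 2 ^ (k + 1) * (P.R : ℝ) ^ ((n : ℝ) - 1)) :
    (L.B : ℝ) ≤ w ^ P.j * (P.R : ℝ) ^ (-(2 / P.j * (l : ℝ))) := by
  have hR0 : 0 < (P.R : ℝ) := by linarith
  have hB : 0 < L.B := hL.1.1.2.1
  -- The defining range of `C(n, l)` exceeds `w^j R^(-3l/j)` by a factor `R^(j/(j+1))`. For `l ≥ 1`
  -- one of the three factors `R^(-l/j)` absorbs it; for `l = 0` the height alone gives the bound.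
  rcases Nat.eq_zero_or_pos l with rfl | hl
  · simpa using B_le hj hB hw (hwh ▸ hL.2.2.le)
  have hl1 : (1 : ℝ) ≤ l := by exact_mod_cast hl
  have h1 : (P.R : ℝ) ^ ((n : ℝ) * P.j / (P.j + 1)) ≤ w ^ P.j * (P.R : ℝ) ^ (P.j / (P.j + 1)) := by
    have h2 : (P.R : ℝ) ^ ((n : ℝ) / (P.j + 1)) ≤ w * (P.R : ℝ) ^ (1 / (P.j + 1)) := by
      rw [← Real.rpow_le_rpow_iff (by positivity) (by positivity) (by linarith : 0 < 1 + P.j),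
        Real.mul_rpow hw.le (by positivity), ← Real.rpow_mul hR0.le, ← Real.rpow_mul hR0.le, hwh,
        add_comm 1 P.j, div_mul_cancel₀ _ (by linarith), div_mul_cancel₀ _ (by linarith),
        mul_assoc, ← Real.rpow_add hR0, sub_add_cancel]
      exact le_mul_of_one_le_left (by positivity) (one_le_pow₀ (by norm_num))
    calc (P.R : ℝ) ^ ((n : ℝ) * P.j / (P.j + 1))
        = ((P.R : ℝ) ^ ((n : ℝ) / (P.j + 1))) ^ P.j := by
          rw [← Real.rpow_mul hR0.le]; ring_nf
      _ ≤ (w * (P.R : ℝ) ^ (1 / (P.j + 1))) ^ P.j := by gcongr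
      _ = _ := by
          rw [Real.mul_rpow hw.le (by positivity), ← Real.rpow_mul hR0.le]; ring_nf
  calc (L.B : ℝ) ≤ (P.R : ℝ) ^ (-(P.lam * (l : ℝ))) * (P.R : ℝ) ^ ((n : ℝ) * P.j / (P.j + 1)) :=
        hL.1.2.2.le
    _ ≤ (P.R : ℝ) ^ (-(P.lam * (l : ℝ))) * (w ^ P.j * (P.R : ℝ) ^ (P.j / (P.j + 1))) := by gcongr
    _ = w ^ P.j * (P.R : ℝ) ^ (-(P.lam * (l : ℝ)) + P.j / (P.j + 1)) := by
        rw [Real.rpow_add hR0]; ring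
    _ ≤ _ := by
        gcongr
        · exact hR.le
        · have h3 : P.j / (P.j + 1) ≤ 1 := by
            rw [div_le_one (by linarith)]; linarith
          have h4 : 1 ≤ 1 / P.j := by rw [le_div_iff₀ hj]; linarith
          have e : P.lam * l = 2 / P.j * l + 1 / P.j * l := by unfold lam; ring
          nlinarith

/-- The product of the coefficients of a line in `C(n, ℓ, k)`. -/
lemma abs_A_mul_B_le_of_mem (hi : 0 < P.i) (hj : 0 < P.j) (hij : P.i + P.j = 1)
    (hR : 1 < (P.R : ℝ)) {n l k : ℕ} {L : Line}
    (hL : L ∈ P.linesAtLevelScale n l k) {w : ℝ} (hw : 0 < w)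
    (hwh : w ^ (1 + P.j) = 2 ^ (k + 1) * (P.R : ℝ) ^ ((n : ℝ) - 1)) :
    |(L.A : ℝ)| * L.B ≤ w * ((P.R : ℝ) ^ l)⁻¹ ^ 2 := by
  have hR0 : 0 < (P.R : ℝ) := by linarith
  have hB : 0 < L.B := hL.1.1.2.1
  have hB' : (0 : ℝ) < L.B := by exact_mod_cast hB
  have hj1 : P.j = 1 - P.i := by linarith
  -- Since `B^(1-i) = B^j`, the gain `R^(-2l/j)` in `B` becomes `R^(-2l)`, and the exponent of `w`
  -- is `(1+j)i + j² = 1`.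
  calc |(L.A : ℝ)| * L.B ≤ (w ^ (1 + P.j) / L.B) ^ P.i * L.B := by
        gcongr
        exact abs_A_le hi hB (hwh ▸ hL.2.2.le)
    _ = w ^ ((1 + P.j) * P.i) * (L.B : ℝ) ^ P.j := by
        rw [hj1, Real.div_rpow (by positivity) hB'.le, ← Real.rpow_mul hw.le, Real.rpow_sub hB',
          Real.rpow_one]
        ring
    _ ≤ w ^ ((1 + P.j) * P.i) * (w ^ P.j * (P.R : ℝ) ^ (-(2 / P.j * (l : ℝ)))) ^ P.j := by
        gcongr
        exact B_le_of_mem hj (by linarith) hR hL hw hwh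
    _ = w ^ ((1 + P.j) * P.i + P.j * P.j) * (P.R : ℝ) ^ (-(2 * (l : ℝ))) := by
        rw [Real.mul_rpow (by positivity) (by positivity), ← Real.rpow_mul hw.le,
          ← Real.rpow_mul hR0.le, Real.rpow_add hw, mul_assoc]
        congr 3
        field_simp
    _ = _ := by
        have e : (1 + P.j) * P.i + P.j * P.j = 1 := by rw [hj1]; ring
        rw [e, Real.rpow_one, Real.rpow_neg hR0.le, inv_pow, ← pow_mul, mul_comm l 2]
        congr 2
        rw [← Real.rpow_natCast]; push_cast; rfl

lemma sq_B_le_of_mem (hj : 0 < P.j) (hj1 : P.j < 1)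
    (hR : 1 < (P.R : ℝ)) {n l k : ℕ} {L L' : Line}
    (hL : L ∈ P.linesAtLevelScale n l k) (hL' : L' ∈ P.linesAtLevelScale n l k)
    {w : ℝ} (hw : 0 < w)
    (hwh : w ^ (1 + P.j) = 2 ^ (k + 1) * (P.R : ℝ) ^ ((n : ℝ) - 1)) :
    (L.B : ℝ) * L'.B ≤ w ^ (2 * P.j) * ((P.R : ℝ) ^ l)⁻¹ ^ 2 := by
  have hR0 : 0 < (P.R : ℝ) := by linarith
  have hB' : (0 : ℝ) < L'.B := by exact_mod_cast hL'.1.1.2.1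
  have h1 : (P.R : ℝ) ^ (-(2 / P.j * (l : ℝ))) ≤ ((P.R : ℝ) ^ l)⁻¹ := by
    rw [← Real.rpow_natCast, ← Real.rpow_neg hR0.le]
    refine Real.rpow_le_rpow_of_exponent_le hR.le (neg_le_neg ?_)
    have : 1 ≤ 2 / P.j := by rw [le_div_iff₀ hj]; linarith
    exact le_mul_of_one_le_left (by positivity) this
  have h2 := B_le_of_mem hj hj1 hR hL hw hwh
  have h3 := B_le_of_mem hj hj1 hR hL' hw hwh
  calc (L.B : ℝ) * L'.B ≤ (w ^ P.j * ((P.R : ℝ) ^ l)⁻¹) * (w ^ P.j * ((P.R : ℝ) ^ l)⁻¹) := by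
        gcongr
        · exact h2.trans (by gcongr)
        · exact h3.trans (by gcongr)
    _ = _ := by rw [two_mul, Real.rpow_add hw]; ring

/-- Bounds for the coefficients of the lines in `C(n, ℓ)` that force the lines meeting a short
segment to be concurrent. -/
lemma exists_coefficient_bounds (hi : 0 < P.i) (hj : 0 < P.j) (hij : P.i + P.j = 1)
    (hR : 1 < (P.R : ℝ)) (n l : ℕ) :
    ∃ a b : ℝ, (∀ L ∈ P.linesAtLevel n l, |(L.A : ℝ)| ≤ a ∧ (L.B : ℝ) ≤ b) ∧ 1 ≤ a ∧ 0 < b ∧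
      2 * a * b ^ 2 * (P.c₁ * (P.R : ℝ) ^ (-(n : ℝ)) * (P.R : ℝ) ^ l) ≤ 1 / 2 := by
  have hR0 : 0 < (P.R : ℝ) := by linarith
  obtain ⟨t, ht⟩ : ∃ t : ℝ, t = -(P.lam * (l : ℝ)) + (n : ℝ) * P.j / (P.j + 1) := ⟨_, rfl⟩
  have hlam : 0 < P.lam := by unfold lam; positivity
  refine ⟨(P.R : ℝ) ^ ((n + P.lam - t) * P.i), (P.R : ℝ) ^ t, ?_, ?_, by positivity, ?_⟩
  · intro L hL
    have hB : (0 : ℝ) < L.B := by exact_mod_cast hL.1.2.1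
    refine ⟨?_, ?_⟩
    · have h1 := hL.2.1
      rw [← Real.rpow_add hR0] at h1
      refine (abs_A_le hi hL.1.2.1 hL.1.2.2.2.le).trans ?_
      rw [Real.rpow_mul hR0.le]
      gcongr
      rw [div_le_iff₀ hB]
      calc (P.R : ℝ) ^ (n : ℝ) = (P.R : ℝ) ^ (n + P.lam - t) * (P.R : ℝ) ^ (t - P.lam) := by
            rw [← Real.rpow_add hR0]; ring_nf
        _ ≤ _ := by
            gcongr
            refine le_of_eq_of_le ?_ h1
            rw [ht]; ring_nf
    · rw [ht, Real.rpow_add hR0]; exact hL.2.2.le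
  · refine Real.one_le_rpow hR.le (mul_nonneg ?_ hi.le)
    have : (n : ℝ) * P.j / (P.j + 1) ≤ n := by
      rw [div_le_iff₀ (by linarith)]
      have : (0 : ℝ) ≤ n := by positivity
      nlinarith
    have h2 : 0 ≤ P.lam * l := by positivity
    linarith
  · have hc : P.c₁ ≤ 1 / 4 * (P.R : ℝ) ^ (-(3 * P.i / P.j)) := min_le_right _ _
    -- The terms in `n` cancel. What is left is `R^(3i/j)`, which the second term in the minimum
    -- defining `c₁` compensates, and `R^(-λ(1+j)l)`, which outweighs `R^l`.
    have e : (n + P.lam - t) * P.i + 2 * t - n = 3 * P.i / P.j - P.lam * (1 + P.j) * l := by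
      have hi' : P.i = 1 - P.j := by linarith
      rw [ht, lam, hi']; field_simp; ring
    rw [← Real.rpow_natCast (P.R : ℝ) l]
    calc 2 * (P.R : ℝ) ^ ((n + P.lam - t) * P.i) * ((P.R : ℝ) ^ t) ^ 2 *
          (P.c₁ * (P.R : ℝ) ^ (-(n : ℝ)) * (P.R : ℝ) ^ (l : ℝ))
        = 2 * P.c₁ * (P.R : ℝ) ^ ((n + P.lam - t) * P.i + 2 * t - n + l) := by
          rw [sq]
          rw [show (n + P.lam - t) * P.i + 2 * t - n + l =
            (n + P.lam - t) * P.i + (t + t) + -(n : ℝ) + l by ring, Real.rpow_add hR0,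
            Real.rpow_add hR0, Real.rpow_add hR0, Real.rpow_add hR0]
          ring
      _ ≤ 2 * (1 / 4 * (P.R : ℝ) ^ (-(3 * P.i / P.j))) * (P.R : ℝ) ^ (3 * P.i / P.j) := by
          rw [e]
          gcongr
          · exact hR.le
          · have : 1 ≤ P.lam * (1 + P.j) := by
              unfold lam
              rw [div_mul_eq_mul_div, le_div_iff₀ hj]; linarith
            have h2 : (0 : ℝ) ≤ l := by positivity
            nlinarith
      _ = 1 / 2 := by
          rw [Real.rpow_neg hR0.le]
          have : (P.R : ℝ) ^ (3 * P.i / P.j) ≠ 0 := by positivity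
          field_simp; norm_num

end Params

/-! ### A line of small height from two close lines -/

/-- Two lines through a point whose denominator is at least `q`, with `d ≤ |y - t|` where `y` is the
ordinate of the first line at distance `X` from the point. The conclusion bounds `q` and the
distances of the point from the vertical line and from the first line. -/
lemma denominator_bounds {i j u w V K E m G c s R α q X η B B' a δ d : ℝ}
    (hi : 0 < i) (hj : 0 < j) (hij : i + j = 1) (hR : 1 < R) (hw : 0 < w) (hV : 0 < V)
    (hV1 : V ≤ 1) (hE : 1 ≤ E) (hm : 0 < m) (hG : 0 < G)
    (hu : u = 8 * E ^ 2 * m) (hEm : 8 * E * m ≤ 1) (hER : 8 * E ≤ R ^ α)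
    (hui : u ^ i * (2 * E * m) * (2 * K) ≤ R ^ (-α) / 3)
    (huj : u ^ j * (2 * E * m) * (2 * K) ≤ R ^ (-α) / 3)
    (hc : c = G * w ^ (1 + j) * R ^ (-α) / (2 * K)) (hK : 0 < K)
    (hs : s * V = G) (hη : η = 2 * E * m * s) (hd : d = G / (4 * E))
    (hq : 0 < q) (hX : 0 ≤ X) (hB' : 0 < B') (hBB : B' ≤ B)
    (ha : a * B ≤ w * V ^ 2) (hBw : B * B' ≤ w ^ (2 * j) * V ^ 2)
    (hqX : q * X ≤ B * B' * η) (hda : d * B ≤ a * X) (hδ : δ ≤ 2 * m * G) :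
    q ^ i * (q * X) ≤ c / 3 ∧ q ^ (1 + j) * (a * X / B + δ) ≤ 2 * c / 3 ∧
      q ^ (1 + j) < V * (w ^ (1 + j) / (2 * K)) := by
  have hR0 : 0 < R := by linarith
  have hE0 : 0 < E := by linarith
  have hB : 0 < B := hB'.trans_le hBB
  have hu0 : 0 < u := by rw [hu]; positivity
  have hs0 : 0 < s := pos_of_mul_pos_left (hs ▸ hG) hV.le
  have hη0 : 0 < η := by rw [hη]; positivity
  have hd0 : 0 < d := by rw [hd]; positivity
  have ha0 : 0 ≤ a := by
    by_contra! h
    have := mul_nonpos_of_nonpos_of_nonneg h.le hX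
    nlinarith [mul_pos hd0 hB]
  -- Here it matters that the first line has the larger `B`: `a B' η` is replaced by `a B η`, and `a
  -- B` is under control. With `d ≤ a X / B` this yields `q ≤ u w V`.
  have hqa : q * (a * X / B) ≤ w * V ^ 2 * η := by
    calc q * (a * X / B) = a / B * (q * X) := by ring
      _ ≤ a / B * (B * B' * η) := by gcongr
      _ = a * B' * η := by field_simp
      _ ≤ a * B * η := by gcongr
      _ ≤ _ := by gcongr
  have hqu : q ≤ u * w * V := by
    have h1 : q * d ≤ w * V ^ 2 * η := by
      refine le_trans ?_ hqa
      gcongr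
      rwa [le_div_iff₀ hB]
    rw [← le_div_iff₀ hd0] at h1
    refine h1.trans_eq ?_
    rw [hd, hη, hu, ← hs]
    field_simp
    ring
  have hquw : q ≤ u * w := hqu.trans (mul_le_of_le_one_right (by positivity) hV1)
  have hsV : η * V ^ 2 ≤ 2 * E * m * G := by
    rw [hη, ← hs]
    have : s * V ^ 2 ≤ s * V := by rw [sq]; gcongr; exact mul_le_of_le_one_left hV.le hV1
    calc 2 * E * m * s * V ^ 2 = 2 * E * m * (s * V ^ 2) := by ring
      _ ≤ _ := by gcongr
  -- Both closeness estimates reduce to this one, with `x = u^i` or `x = u^j`; `c` carries the same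
  -- factor `G w^(1+j)`.
  have hcc : ∀ x, x * (2 * E * m) * (2 * K) ≤ R ^ (-α) / 3 →
      x * w ^ (1 + j) * (2 * E * m * G) ≤ c / 3 := by
    intro x hx
    have h1 : x * (2 * E * m) ≤ R ^ (-α) / 3 / (2 * K) := by
      rwa [le_div_iff₀ (by positivity)]
    calc x * w ^ (1 + j) * (2 * E * m * G) = (x * (2 * E * m)) * (G * w ^ (1 + j)) := by ring
      _ ≤ (R ^ (-α) / 3 / (2 * K)) * (G * w ^ (1 + j)) := by gcongr
      _ = c / 3 := by rw [hc]; ring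
  have hqj : q ^ (1 + j) ≤ u ^ j * u * w ^ (1 + j) := by
    calc q ^ (1 + j) ≤ (u * w) ^ (1 + j) := by gcongr
      _ = _ := by rw [Real.mul_rpow hu0.le hw.le, add_comm 1 j, Real.rpow_add_one hu0.ne']
  refine ⟨?_, ?_, ?_⟩
  · calc q ^ i * (q * X) ≤ (u * w) ^ i * (w ^ (2 * j) * V ^ 2 * η) := by
          have h1 : q * X ≤ w ^ (2 * j) * V ^ 2 * η := hqX.trans (by gcongr)
          gcongr
      _ = u ^ i * w ^ (1 + j) * (η * V ^ 2) := by
          rw [Real.mul_rpow hu0.le hw.le, show 1 + j = i + 2 * j by linarith, Real.rpow_add hw]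
          ring
      _ ≤ u ^ i * w ^ (1 + j) * (2 * E * m * G) := by gcongr
      _ ≤ c / 3 := hcc _ hui
  · have h1 : q ^ (1 + j) * (a * X / B) ≤ c / 3 := by
      calc q ^ (1 + j) * (a * X / B) = q ^ j * (q * (a * X / B)) := by
            rw [add_comm 1 j, Real.rpow_add_one hq.ne']; ring
        _ ≤ (u * w) ^ j * (w * V ^ 2 * η) := by gcongr
        _ = u ^ j * w ^ (1 + j) * (η * V ^ 2) := by
            rw [Real.mul_rpow hu0.le hw.le, add_comm 1 j, Real.rpow_add_one hw.ne']; ring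
        _ ≤ u ^ j * w ^ (1 + j) * (2 * E * m * G) := by gcongr
        _ ≤ c / 3 := hcc _ huj
    have h2 : q ^ (1 + j) * δ ≤ c / 3 := by
      have h3 : u * (2 * m * G) ≤ 2 * E * m * G := by
        rw [hu]
        calc 8 * E ^ 2 * m * (2 * m * G) = (8 * E * m) * (2 * E * m * G) := by ring
          _ ≤ _ := mul_le_of_le_one_left (by positivity) hEm
      calc q ^ (1 + j) * δ ≤ q ^ (1 + j) * (2 * m * G) := by gcongr
        _ ≤ u ^ j * u * w ^ (1 + j) * (2 * m * G) := by gcongr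
        _ = u ^ j * w ^ (1 + j) * (u * (2 * m * G)) := by ring
        _ ≤ u ^ j * w ^ (1 + j) * (2 * E * m * G) := by gcongr
        _ ≤ c / 3 := hcc _ huj
    rw [mul_add]; linarith
  · have h1 : u ^ j * u * (2 * K) < 1 := by
      have h2 : R ^ (-α) * R ^ α = 1 := by
        rw [← Real.rpow_add hR0, neg_add_cancel, Real.rpow_zero]
      have h3 : 0 < R ^ (-α) := by positivity
      calc u ^ j * u * (2 * K) = (u ^ j * (2 * E * m) * (2 * K)) * (4 * E) := by rw [hu]; ring
        _ ≤ R ^ (-α) / 3 * (4 * E) := by gcongr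
        _ < 1 := by nlinarith
    calc q ^ (1 + j) ≤ (u * w * V) ^ (1 + j) := by gcongr
      _ = u ^ j * u * w ^ (1 + j) * V ^ (1 + j) := by
          rw [Real.mul_rpow (by positivity) hV.le, Real.mul_rpow hu0.le hw.le, add_comm 1 j,
            Real.rpow_add_one hu0.ne']
      _ ≤ u ^ j * u * w ^ (1 + j) * V := by
          gcongr
          calc V ^ (1 + j) ≤ V ^ (1 : ℝ) :=
                Real.rpow_le_rpow_of_exponent_ge hV hV1 (by linarith)
            _ = V := Real.rpow_one V
      _ = (u ^ j * u * (2 * K)) * (V * (w ^ (1 + j) / (2 * K))) := by field_simp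
      _ < 1 * (V * (w ^ (1 + j) / (2 * K))) := by gcongr
      _ = _ := one_mul _

namespace Params

variable {P : Params}

/-- A point that is close to a rational point `(p / q, t / q)` lies in `Δ(L)` for a line `L` of
small height. -/
lemma exists_line_of_close (hi : 0 < P.i) (hj : 0 < P.j) (hij : P.i + P.j = 1)
    (hθ : IsBadConstant P.i P.θ P.cθ) (hc : P.c ≤ P.cθ) (hc0 : 0 < P.c) {p t : ℤ} {q : ℕ}
    (hq : 0 < q) {z : ℝ} (hz : z ∈ Set.Icc (0 : ℝ) 1)
    (hp : (q : ℝ) ^ P.i * |q * P.θ - p| ≤ P.c / 3)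
    (ht : (q : ℝ) ^ (1 + P.j) * |z - t / q| ≤ 2 * P.c / 3) :
    ∃ L : Line, L.IsNormalized ∧ 1 ≤ P.height L ∧ P.height L ≤ (q : ℝ) ^ (1 + P.j) ∧
      z ∈ P.Δ L := by
  have hq0 : (0 : ℝ) < q := by exact_mod_cast hq
  have hlt : q < (⌊(q : ℝ) ^ P.i⌋₊ + 1) * (⌊(q : ℝ) ^ P.j⌋₊ + 1) := by
    have h1 := Nat.lt_floor_add_one ((q : ℝ) ^ P.i)
    have h2 := Nat.lt_floor_add_one ((q : ℝ) ^ P.j)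
    have h3 : (q : ℝ) < (⌊(q : ℝ) ^ P.i⌋₊ + 1) * (⌊(q : ℝ) ^ P.j⌋₊ + 1) := by
      calc (q : ℝ) = (q : ℝ) ^ P.i * (q : ℝ) ^ P.j := by
            rw [← Real.rpow_add hq0, hij, Real.rpow_one]
        _ < _ := by gcongr
    exact_mod_cast h3
  obtain ⟨L, hprim, hA, hB0, hB, hAB, hrel⟩ := exists_line_through p t hq hlt
  have hA' : |(L.A : ℝ)| ≤ (q : ℝ) ^ P.i := by
    have h1 : |(L.A : ℝ)| ≤ (⌊(q : ℝ) ^ P.i⌋₊ : ℝ) := by exact_mod_cast hA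
    exact h1.trans (Nat.floor_le (by positivity))
  have hB' : (L.B : ℝ) ≤ (q : ℝ) ^ P.j := by
    have h1 : (L.B : ℝ) ≤ (⌊(q : ℝ) ^ P.j⌋₊ : ℝ) := by exact_mod_cast hB
    exact h1.trans (Nat.floor_le (by positivity))
  have hrel' : (L.A : ℝ) * p - L.B * t + L.C * q = 0 := by exact_mod_cast hrel
  have hAq : |(L.A : ℝ)| ^ (1 / P.i) ≤ q := by
    calc |(L.A : ℝ)| ^ (1 / P.i) ≤ ((q : ℝ) ^ P.i) ^ (1 / P.i) := by gcongr
      _ = q := by rw [← Real.rpow_mul hq0.le, mul_one_div_cancel hi.ne', Real.rpow_one]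
  have hAX : |(L.A : ℝ)| * |q * P.θ - p| ≤ P.c / 3 :=
    (mul_le_mul_of_nonneg_right hA' (abs_nonneg _)).trans hp
  -- If `B = 0`, then `|A|^(1/i) ≤ q` gives `|A|^(1/i) |Aθ + C| ≤ |A| |qθ - p| ≤ c/3`, against `c ≤
  -- c(θ)`.
  rcases hB0.eq_or_lt with h0 | hpos
  · exfalso
    rw [← h0] at hrel'
    have hA0 : L.A ≠ 0 := by simpa [← h0] using hAB
    obtain ⟨p', hp'⟩ : ∃ p' : ℤ, |((L.A.natAbs : ℕ) : ℝ) * P.θ - p'| = |L.A * P.θ + L.C| := by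
      rw [Nat.cast_natAbs, Int.cast_abs]
      rcases abs_choice (L.A : ℝ) with h | h <;> rw [h]
      · exact ⟨-L.C, by push_cast; rw [sub_neg_eq_add]⟩
      · refine ⟨L.C, ?_⟩
        rw [← abs_neg]; ring_nf
    have h1 := hθ.2 p' L.A.natAbs (Int.natAbs_pos.2 hA0)
    rw [hp', Nat.cast_natAbs, Int.cast_abs] at h1
    have h2 : |L.A * P.θ + L.C| * q ≤ P.c / 3 := by
      refine le_of_eq_of_le ?_ hAX
      rw [← abs_mul, ← abs_of_pos hq0, ← abs_mul, abs_of_pos hq0]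
      congr 1
      push_cast at hrel'
      linear_combination hrel'
    have h3 : |(L.A : ℝ)| ^ (1 / P.i) * |L.A * P.θ + L.C| ≤ q * |L.A * P.θ + L.C| := by gcongr
    linarith
  · have hBpos : (0 : ℝ) < L.B := by exact_mod_cast hpos
    have hB1 : (1 : ℝ) ≤ L.B := by exact_mod_cast hpos
    have hsize : P.size L ≤ q := by
      refine max_le hAq ?_
      rw [abs_of_pos hBpos]
      calc (L.B : ℝ) ^ (1 / P.j) ≤ ((q : ℝ) ^ P.j) ^ (1 / P.j) := by gcongr
        _ = q := by rw [← Real.rpow_mul hq0.le, mul_one_div_cancel hj.ne', Real.rpow_one]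
    have hsize1 : 1 ≤ P.size L := by
      refine le_max_of_le_right ?_
      rw [abs_of_pos hBpos]
      exact Real.one_le_rpow hB1 (by positivity)
    refine ⟨L, ⟨hprim, hpos⟩, one_le_mul_of_one_le_of_one_le hB1 hsize1, ?_, hz, ?_⟩
    · rw [height, add_comm, Real.rpow_add_one hq0.ne']
      gcongr
    · have h1 : |(L.A : ℝ) * P.θ - L.B * z + L.C| * q ≤ P.c := by
        have e : ((L.A : ℝ) * P.θ - L.B * z + L.C) * q =
            L.A * (q * P.θ - p) - q * L.B * (z - t / q) := by
          field_simp; linear_combination hrel'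
        calc |(L.A : ℝ) * P.θ - L.B * z + L.C| * q
            = |L.A * (q * P.θ - p) - q * L.B * (z - t / q)| := by
              rw [← e, abs_mul, abs_of_pos hq0]
          _ ≤ |L.A * (q * P.θ - p)| + |q * L.B * (z - t / q)| := abs_sub _ _
          _ = |(L.A : ℝ)| * |q * P.θ - p| + q * L.B * |z - t / q| := by
              rw [abs_mul, abs_mul _ (z - t / q : ℝ), abs_of_pos (mul_pos hq0 hBpos)]
          _ ≤ P.c / 3 + q * (q : ℝ) ^ P.j * |z - t / q| := by gcongr
          _ = P.c / 3 + (q : ℝ) ^ (1 + P.j) * |z - t / q| := by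
              rw [add_comm 1 P.j, Real.rpow_add_one hq0.ne']; ring
          _ ≤ _ := by linarith
      rw [le_div_iff₀ (by linarith)]
      exact (mul_le_mul_of_nonneg_left hsize (abs_nonneg _)).trans h1

end Params

lemma Line.ordinate_sub_eq {L : Line} (h : L.IsNormalized) {p t : ℤ} {q : ℕ} (hq : 0 < q)
    (hL : L.A * p - L.B * t + L.C * q = 0) (θ : ℝ) :
    L.ordinate θ - t / q = L.A / L.B * (θ - p / q) := by
  have hq0 : (0 : ℝ) < q := by exact_mod_cast hq
  have hB := h.B_pos
  have hL' : (L.A : ℝ) * p - L.B * t + L.C * q = 0 := by exact_mod_cast hL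
  unfold ordinate
  field_simp
  linear_combination hL'

/-- For two lines through a rational point with denominator `q`, the distance from the vertical line
to the point is at most the distance of the ordinates times `BB' / q`. -/
lemma Line.mul_abs_le {L L' : Line} (h : L.IsNormalized) (h' : L'.IsNormalized) (hne : L ≠ L')
    {p t : ℤ} {q : ℕ} (hq : 0 < q) (hprim : Int.gcd (Int.gcd p t) q = 1)
    (hL : L.A * p - L.B * t + L.C * q = 0) (hL' : L'.A * p - L'.B * t + L'.C * q = 0) (θ : ℝ) :
    q * |θ - p / q| ≤ L.B * L'.B * |L.ordinate θ - L'.ordinate θ| := by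
  obtain ⟨h0, hdvd⟩ := exists_cross_eq h h' hne (q := q) (by omega) hprim hL hL'
  have hB := h.B_pos
  have hB' := h'.B_pos
  have h1 : (q : ℤ) ≤ |L.A * L'.B - L'.A * L.B| :=
    Int.le_of_dvd (abs_pos.2 h0) ((dvd_abs _ _).2 hdvd)
  have h2 : (q : ℝ) ≤ |(L.A : ℝ) * L'.B - L'.A * L.B| := by exact_mod_cast h1
  have e : L.B * L'.B * (L.ordinate θ - L'.ordinate θ) =
      (L.A * L'.B - L'.A * L.B) * (θ - p / q) := by
    have h3 := ordinate_sub_eq h hq hL θ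
    have h4 := ordinate_sub_eq h' hq hL' θ
    have : L.ordinate θ - L'.ordinate θ = (L.A / L.B - L'.A / L'.B) * (θ - p / q) := by
      linear_combination h3 - h4
    rw [this]; field_simp
  calc q * |θ - p / q| ≤ |(L.A : ℝ) * L'.B - L'.A * L.B| * |θ - p / q| := by gcongr
    _ = |L.B * L'.B * (L.ordinate θ - L'.ordinate θ)| := by rw [e, abs_mul]
    _ = _ := by rw [abs_mul, abs_of_pos (mul_pos hB hB')]

namespace Params

variable {P : Params}

lemma c_le (hR : 0 < P.R) : P.c ≤ P.cθ := by
  have : (0 : ℝ) < P.R := by exact_mod_cast hR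
  rw [c, div_le_iff₀ (by positivity)]
  exact min_le_left _ _

lemma c_pos (hc₁ : 0 < P.c₁) (hR : 0 < P.R) : 0 < P.c := by
  have : (0 : ℝ) < P.R := by exact_mod_cast hR
  exact div_pos hc₁ (by positivity)

lemma c₁_le (hi : 0 < P.i) (hj : 0 < P.j) (hR : 1 < (P.R : ℝ)) : P.c₁ ≤ 1 / 4 := by
  have h : (P.R : ℝ) ^ (-(3 * P.i / P.j)) ≤ 1 :=
    Real.rpow_le_one_of_one_le_of_nonpos hR.le (by rw [neg_nonpos]; positivity)
  exact (min_le_right _ _).trans (by linarith)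

/-- Two lines of `C(n, ℓ, k)` that are close to each other, and whose intersection is not too close,
produce a line of small height that nearly contains one of the given points. -/
lemma exists_low_line (hi : 0 < P.i) (hj : 0 < P.j) (hij : P.i + P.j = 1)
    (hθ : IsBadConstant P.i P.θ P.cθ) (hR : 1 < (P.R : ℝ)) (hc₁ : 0 < P.c₁)
    {n l k : ℕ} {E m G s : ℝ} (hE : 1 ≤ E) (hm : 0 < m) (hEm : 8 * E * m ≤ 1)
    (hER : 8 * E ≤ (P.R : ℝ) ^ P.α)
    (hui : (8 * E ^ 2 * m) ^ P.i * (2 * E * m) * (2 * 2 ^ k) ≤ (P.R : ℝ) ^ (-P.α) / 3)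
    (huj : (8 * E ^ 2 * m) ^ P.j * (2 * E * m) * (2 * 2 ^ k) ≤ (P.R : ℝ) ^ (-P.α) / 3)
    (hG : G = P.c₁ * (P.R : ℝ) ^ (-(n : ℝ))) (hs : s = G * (P.R : ℝ) ^ l)
    {L L' : Line} (hL : L ∈ P.linesAtLevelScale n l k) (hL' : L' ∈ P.linesAtLevelScale n l k)
    (hne : L ≠ L') {p t : ℤ} {q : ℕ} (hq : 0 < q) (hprim : Int.gcd (Int.gcd p t) q = 1)
    (hLp : L.A * p - L.B * t + L.C * q = 0) (hLp' : L'.A * p - L'.B * t + L'.C * q = 0)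
    (hη : |L.ordinate P.θ - L'.ordinate P.θ| ≤ 2 * E * m * s)
    (hd : G / (4 * E) ≤ |L.ordinate P.θ - t / q|) (hd' : G / (4 * E) ≤ |L'.ordinate P.θ - t / q|)
    {z z' : ℝ} (hz01 : z ∈ Set.Icc (0 : ℝ) 1) (hz01' : z' ∈ Set.Icc (0 : ℝ) 1)
    (hz : |z - L.ordinate P.θ| ≤ 2 * m * G) (hz' : |z' - L'.ordinate P.θ| ≤ 2 * m * G) :
    ∃ M : Line, M.IsNormalized ∧ 1 ≤ P.height M ∧
      P.height M < (P.R : ℝ) ^ ((n : ℝ) - l - 1) ∧ (z ∈ P.Δ M ∨ z' ∈ P.Δ M) := by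
  -- The centre found in `Δ(M)` is the one attached to the line with the larger `B`; hence the
  -- disjunction in the conclusion.
  wlog hBB : L'.B ≤ L.B generalizing L L' z z'
  · obtain ⟨M, h1, h2, h3, h4⟩ := this hL' hL hne.symm hLp' hLp (by rwa [abs_sub_comm]) hd' hd
      hz01' hz01 hz' hz (by omega)
    exact ⟨M, h1, h2, h3, h4.symm⟩
  have hR0 : 0 < (P.R : ℝ) := by linarith
  have hRN : 0 < P.R := by exact_mod_cast hR0
  have hq0 : (0 : ℝ) < q := by exact_mod_cast hq
  have hn : L.IsNormalized := normalized_of_mem_linesAt hL.1.1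
  have hn' : L'.IsNormalized := normalized_of_mem_linesAt hL'.1.1
  have hB := hn.B_pos
  -- `w^(1+j)` is the upper end of the range of heights, so `B ≤ w^j` throughout the class.
  set w : ℝ := (2 ^ (k + 1) * (P.R : ℝ) ^ ((n : ℝ) - 1)) ^ (1 / (1 + P.j)) with hw
  have hw0 : 0 < w := by positivity
  have hwh : w ^ (1 + P.j) = 2 ^ (k + 1) * (P.R : ℝ) ^ ((n : ℝ) - 1) := by
    rw [hw, ← Real.rpow_mul (by positivity), one_div_mul_cancel (by linarith), Real.rpow_one]
  have hG0 : 0 < G := by rw [hG]; positivity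
  have hV1 : ((P.R : ℝ) ^ l)⁻¹ ≤ 1 := inv_le_one_of_one_le₀ (one_le_pow₀ hR.le)
  have hordL : ∀ y : ℝ, y = |L.ordinate P.θ - t / q| →
      y = |(L.A : ℝ)| * |P.θ - p / q| / L.B := by
    rintro _ rfl
    rw [Line.ordinate_sub_eq hn hq hLp, abs_mul, abs_div, abs_of_pos hB]; ring
  have hK2 : (2 : ℝ) * 2 ^ k = 2 ^ (k + 1) := by ring
  obtain ⟨h1, h2, h3⟩ := denominator_bounds (i := P.i) (j := P.j) (R := P.R) (α := P.α) (w := w)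
    (V := ((P.R : ℝ) ^ l)⁻¹) (K := 2 ^ k) (E := E) (m := m) (G := G) (c := P.c) (s := s) (q := q)
    (X := |P.θ - p / q|) (B := L.B) (B' := L'.B) (a := |(L.A : ℝ)|) (δ := 2 * m * G)
    (d := G / (4 * E)) hi hj hij hR hw0 (by positivity) hV1 hE hm hG0 rfl hEm hER hui huj
    (by
      rw [hwh, c, hG, hK2, Real.rpow_sub hR0, Real.rpow_add hR0, Real.rpow_neg hR0.le,
        Real.rpow_neg hR0.le, Real.rpow_one]
      field_simp)
    (by positivity) (by rw [hs]; field_simp) rfl rfl hq0 (abs_nonneg _) hn'.B_pos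
    (by exact_mod_cast hBB) (abs_A_mul_B_le_of_mem hi hj hij hR hL hw0 hwh)
    (sq_B_le_of_mem hj (by linarith) hR hL hL' hw0 hwh)
    ((Line.mul_abs_le hn hn' hne hq hprim hLp hLp' P.θ).trans
      (mul_le_mul_of_nonneg_left hη (mul_pos hB hn'.B_pos).le))
    (by
      rw [← le_div_iff₀ hB, ← hordL _ rfl]; exact hd)
    le_rfl
  obtain ⟨M, hM, hM1, hMq, hzM⟩ := exists_line_of_close hi hj hij hθ (c_le hRN) (c_pos hc₁ hRN)
    (p := p) (t := t) hq hz01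
    (by
      have e : (q : ℝ) * P.θ - p = q * (P.θ - p / q) := by field_simp
      rwa [e, abs_mul, abs_of_pos hq0])
    (by
      refine le_trans ?_ h2
      gcongr
      rw [← hordL _ rfl, add_comm]
      exact (abs_sub_le _ _ _).trans (by gcongr))
  refine ⟨M, hM, hM1, hMq.trans_lt (h3.trans_eq ?_), Or.inl hzM⟩
  rw [hwh, hK2, ← Real.rpow_natCast, ← Real.rpow_neg hR0.le, mul_div_cancel_left₀ _ (by positivity),
    ← Real.rpow_add hR0]
  ring_nf

/-- If `R^k ≤ H(M) < R^(k+1)`, then `M ∈ C(k+1)`; the exponent `N - 1` in the bound is what makes `k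
+ 1 < N`. -/
lemma exists_mem_linesAt (hR : 1 < (P.R : ℝ)) {M : Line} (hM : M.IsNormalized)
    (hM1 : 1 ≤ P.height M) {N : ℕ} (hMN : P.height M < (P.R : ℝ) ^ ((N : ℝ) - 1)) :
    ∃ m < N, M ∈ P.linesAt m := by
  obtain ⟨k, hk, hk'⟩ := exists_nat_pow_near hM1 hR
  refine ⟨k + 1, ?_, hM.1, hM.2, ?_, ?_⟩
  · have h1 : (P.R : ℝ) ^ (k : ℝ) < (P.R : ℝ) ^ ((N : ℝ) - 1) := by
      rw [Real.rpow_natCast]; exact hk.trans_lt hMN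
    rw [Real.rpow_lt_rpow_left_iff hR] at h1
    have : ((k + 1 : ℕ) : ℝ) < N := by push_cast; linarith
    exact_mod_cast this
  · push_cast; rw [add_sub_cancel_right, Real.rpow_natCast]; exact hk
  · rw [Real.rpow_natCast]; exact hk'

/-- All lines of `C(n, ℓ)` that meet a short vertical segment are concurrent. -/
lemma exists_common_point (hi : 0 < P.i) (hj : 0 < P.j) (hij : P.i + P.j = 1)
    (hR : 1 < (P.R : ℝ)) {n l : ℕ} {F : Set Line} (hF : F ⊆ P.linesAtLevel n l)
    {σ : ℝ} (hσ : σ < 2 * (P.c₁ * (P.R : ℝ) ^ (-(n : ℝ)) * (P.R : ℝ) ^ l))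
    (hdist : ∀ L ∈ F, ∀ L' ∈ F, |L.ordinate P.θ - L'.ordinate P.θ| ≤ σ) (hne : F.Nontrivial) :
    ∃ (p t : ℤ) (q : ℕ), 0 < q ∧ Int.gcd (Int.gcd p t) q = 1 ∧
      ∀ L ∈ F, L.A * p - L.B * t + L.C * q = 0 := by
  obtain ⟨a, b, hab, ha, hb, hprod⟩ := exists_coefficient_bounds hi hj hij hR n l
  have hnorm : ∀ L ∈ F, L.IsNormalized := fun L hL => normalized_of_mem_linesAt (hF hL).1
  have h2 : 2 * a * b ^ 2 * σ < 1 := by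
    have h3 : 0 < 2 * a * b ^ 2 := by positivity
    nlinarith
  obtain ⟨L, hL, L', hL', hLL⟩ := hne
  have hσ0 : 0 ≤ σ := (abs_nonneg _).trans (hdist L hL L' hL')
  have h1 : b ^ 2 * σ < 1 := by
    refine lt_of_le_of_lt ?_ h2
    rw [mul_assoc]
    exact le_mul_of_one_le_left (by positivity) (by linarith)
  obtain ⟨p, t, q, hq, hprim, hcommon⟩ := Line.exists_intersection
    ((hnorm L hL).not_parallel (hnorm L' hL') hLL (hab L (hF hL)).2 (hab L' (hF hL')).2
      (hdist L hL L' hL') h1)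
  refine ⟨p, t, q, hq, hprim, fun M hM => hcommon M ?_⟩
  exact Line.det_eq_zero (hnorm L hL) (hnorm L' hL') (hnorm M hM)
    (hab L (hF hL)).1 (hab L' (hF hL')).1 (hab M (hF hM)).1
    (hab L (hF hL)).2 (hab L' (hF hL')).2 (hab M (hF hM)).2
    (hdist L hL L' hL') (hdist L' hL' M hM) (hdist L hL M hM) h2

end Params

/-! ### The count -/

lemma Set.finite_and_ncard_le_of_forall_finset {α : Type*} {S : Set α} {X : ℝ}
    (h : ∀ Z : Finset α, (Z : Set α) ⊆ S → (Z.card : ℝ) ≤ X) :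
    S.Finite ∧ (S.ncard : ℝ) ≤ X := by
  have hfin : S.Finite := by
    by_contra hinf
    obtain ⟨Z, hZ, hcard⟩ := Set.Infinite.exists_subset_card_eq hinf (⌊X⌋₊ + 1)
    have h1 := h Z hZ
    rw [hcard] at h1
    push_cast at h1
    exact (Nat.lt_floor_add_one X).not_ge h1
  refine ⟨hfin, ?_⟩
  rw [Set.ncard_eq_toFinset_card S hfin]
  exact h _ (by simp)

/-- The bounds for numbers of intervals that the choice `E ^ β ≥ 160 ρ² R ^ ε` provides. -/
lemma covering_number_bounds {R E m ρ β ε : ℝ} (hR : 1 < R) (hE : 1 ≤ E) (hER : E ≤ R)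
    (hm : 0 < m) (hRm : 1 ≤ m * R) (hEm : E * m ≤ 1) (hρ : 1 ≤ ρ) (hβ : 0 < β) (hβ1 : β ≤ 1)
    (hEβ : 160 * ρ ^ 2 * R ^ ε ≤ E ^ β) :
    ρ * (6 * m * R + 1) ^ β * (ρ * (3 / (E * m) + 1) ^ β) ≤ R ^ (β - ε) / 2 ∧
      ρ * (2 * R / E + 1) ^ β ≤ R ^ (β - ε) / 2 := by
  have hR0 : 0 < R := by linarith
  have hE0 : 0 < E := by linarith
  have key : ∀ K x N : ℝ, 0 ≤ x → 1 ≤ K → 0 ≤ N → x ≤ K * R / E → K * N ≤ 80 * ρ ^ 2 →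
      N * x ^ β ≤ R ^ (β - ε) / 2 := by
    intro K x N hx hK hN hxE hKN
    have hKβ : K ^ β ≤ K := by
      calc K ^ β ≤ K ^ (1 : ℝ) := Real.rpow_le_rpow_of_exponent_le hK hβ1
        _ = K := Real.rpow_one K
    calc N * x ^ β ≤ N * (K * R / E) ^ β := by gcongr
      _ = N * (K ^ β * R ^ β) / E ^ β := by
          rw [Real.div_rpow (by positivity) hE0.le, Real.mul_rpow (by positivity) hR0.le]; ring
      _ ≤ N * (K * R ^ β) / (160 * ρ ^ 2 * R ^ ε) := by gcongr
      _ = (K * N) * R ^ β / (160 * ρ ^ 2 * R ^ ε) := by ring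
      _ ≤ (80 * ρ ^ 2) * R ^ β / (160 * ρ ^ 2 * R ^ ε) := by gcongr
      _ = R ^ (β - ε) / 2 := by
          rw [Real.rpow_sub hR0]; field_simp; norm_num
  constructor
  · have e : ρ * (6 * m * R + 1) ^ β * (ρ * (3 / (E * m) + 1) ^ β) =
        ρ ^ 2 * ((6 * m * R + 1) * (3 / (E * m) + 1)) ^ β := by
      rw [Real.mul_rpow (by positivity) (by positivity)]; ring
    rw [e]
    -- The two factors are at most `7mR` and `4/(Em)`; `m` cancels in the product, leaving `28 R /
    -- E`.
    refine key 28 _ _ (by positivity) (by norm_num) (by positivity) ?_ (by nlinarith)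
    have h1 : 6 * m * R + 1 ≤ 7 * m * R := by linarith
    have h2 : 3 / (E * m) + 1 ≤ 4 / (E * m) := by
      have : 1 ≤ 1 / (E * m) := by rw [le_div_iff₀ (by positivity)]; linarith
      have e : 4 / (E * m) = 3 / (E * m) + 1 / (E * m) := by ring
      linarith
    calc (6 * m * R + 1) * (3 / (E * m) + 1) ≤ (7 * m * R) * (4 / (E * m)) := by gcongr
      _ = 28 * R / E := by field_simp; norm_num
  · refine key 3 _ _ (by positivity) (by norm_num) (by positivity) ?_ (by nlinarith)
    have : 1 ≤ R / E := by rw [le_div_iff₀ hE0]; linarith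
    have e : 3 * R / E = 2 * R / E + R / E := by ring
    linarith

/-- A point of an interval that meets `Δ(L)` is close to the line `L`. -/
lemma Params.abs_center_sub_ordinate_le {P : Params} (hR : 1 < (P.R : ℝ)) (hc₁ : 0 < P.c₁)
    {n l k : ℕ} {L : Line} (hL : L ∈ P.linesAtLevelScale n l k) {z m G : ℝ}
    (hz : (P.interval (n + 1) z ∩ P.Δ L).Nonempty)
    (hG : G = P.c₁ * (P.R : ℝ) ^ (-(n : ℝ)))
    (hm : m = max ((P.R : ℝ)⁻¹) ((2 ^ k : ℝ)⁻¹ * (P.R : ℝ) ^ (-P.α))) :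
    |z - L.ordinate P.θ| ≤ 3 / 2 * m * G := by
  have hR0 : 0 < (P.R : ℝ) := by linarith
  have hG0 : 0 < G := by rw [hG]; positivity
  obtain ⟨x, hxz, hxL⟩ := hz
  have h1 : |x - z| ≤ 1 / 2 * m * G := by
    have h2 : |x - z| ≤ P.radius (n + 1) := by
      rw [← Real.dist_eq]; exact Metric.mem_closedBall.1 hxz
    have e : P.radius (n + 1) = 1 / 2 * (P.R : ℝ)⁻¹ * G := by
      rw [Params.radius, hG, Nat.cast_add, Nat.cast_one, neg_add, Real.rpow_add hR0,
        Real.rpow_neg_one]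
      ring
    refine h2.trans (e.trans_le ?_)
    gcongr
    rw [hm]; exact le_max_left _ _
  have h2 : |x - L.ordinate P.θ| ≤ m * G := by
    refine (Params.abs_sub_ordinate_le hL.1.1.2.1 hxL).trans ?_
    have hH : 0 < 2 ^ k * (P.R : ℝ) ^ ((n : ℝ) - 1) := by positivity
    calc P.c / P.height L ≤ P.c / (2 ^ k * (P.R : ℝ) ^ ((n : ℝ) - 1)) := by
          gcongr
          · exact (Params.c_pos hc₁ (by exact_mod_cast hR0)).le
          · exact hL.2.1
      _ = (2 ^ k : ℝ)⁻¹ * (P.R : ℝ) ^ (-P.α) * G := by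
          rw [Params.c, hG, Real.rpow_sub hR0, Real.rpow_add hR0, Real.rpow_neg hR0.le,
            Real.rpow_neg hR0.le, Real.rpow_one]
          field_simp
      _ ≤ m * G := by
          gcongr
          rw [hm]; exact le_max_right _ _
  rw [abs_le] at *
  constructor <;> linarith [h1.1, h1.2, h2.1, h2.2]

set_option maxHeartbeats 1000000 in
theorem theorem14 (P : Params) (b₁ b₂ ε : ℝ) (μ : MeasureTheory.Measure ℝ)
    [MeasureTheory.IsProbabilityMeasure μ] (T : Choices)
    (hi : 0 < P.i) (hj : 0 < P.j) (hij : P.i + P.j = 1)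
    (hθ : IsBadConstant P.i P.θ P.cθ)
    (hsupp : μ.support ⊆ Set.Icc (0 : ℝ) 1)
    (hμ : PowerLaw μ P.β b₁ b₂)
    (hR : 0 < P.R)
    (hT : T.IsAdmissible P μ)
    (h₁ : (P.R : ℝ) ^ (-ε) + (P.R : ℝ) ^ (ε - P.α * P.β) < 1 / 2 * (b₁ / (4 * b₂)) ^ 2)
    (h₂ : (4 : ℝ) ^ (2 / (P.i * P.j) + 2) * (b₂ / b₁) <
      (P.R : ℝ) ^ (P.α * P.β - (4 / (P.β * P.i * P.j) + 1) * ε))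
    (n l k : ℕ) (hl : l ≤ n) (y : ℝ) (hy : y ∈ T.J P (n - l)) :
    {z | z ∈ T.IWithin P (n + 1) (P.interval (n - l) y) ∧
        ∃ L ∈ P.linesAtLevelScale n l k, (P.interval (n + 1) z ∩ P.Δ L).Nonempty}.Finite ∧
      ({z | z ∈ T.IWithin P (n + 1) (P.interval (n - l) y) ∧
        ∃ L ∈ P.linesAtLevelScale n l k, (P.interval (n + 1) z ∩ P.Δ L).Nonempty}.ncard : ℝ) ≤
        (P.R : ℝ) ^ (P.β - ε) := by
  refine Set.finite_and_ncard_le_of_forall_finset fun Z hZ => ?_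
  by_contra! hcard
  -- numerical preliminaries
  have hβ := hμ.1
  have hb₁ := hμ.2.1
  have hβ1 : P.β ≤ 1 := hμ.exponent_le_one hsupp
  have hbb : b₁ ≤ b₂ := hμ.lower_le_upper
    (Measure.nonempty_support (IsProbabilityMeasure.ne_zero μ))
  have hR1 : (1 : ℝ) ≤ P.R := by exact_mod_cast hR
  have hρ : 1 ≤ b₂ / b₁ := by rw [le_div_iff₀ hb₁]; linarith
  have hRε := rpow_gt_of_sum_lt hR1 hb₁ hbb h₁
  obtain ⟨hR', hε⟩ := one_lt_and_pos_of_rpow_gt hR1 hρ hRε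
  have hR0 : 0 < (P.R : ℝ) := by linarith
  have hα0 : 0 < P.α := by unfold Params.α; positivity
  have hijα : P.α ≤ P.i * P.j / 4 := by
    have : 0 < P.i * P.j := by positivity
    rw [Params.α, mul_assoc]
    exact div_le_div_of_nonneg_right (mul_le_of_le_one_left this.le hβ1) (by norm_num)
  have hαi : 2 * P.α ≤ P.i := by linarith [mul_le_of_le_one_right hi.le (by linarith : P.j ≤ 1)]
  have hαj : 2 * P.α ≤ P.j := by linarith [mul_le_of_le_one_left hj.le (by linarith : P.i ≤ 1)]
  have hα1 : P.α ≤ 1 := by linarith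
  have hc₁ : 0 < P.c₁ := Params.c₁_pos hθ hR
  have hαε : 4 / (P.β * P.i * P.j) = 1 / P.α := by unfold Params.α; field_simp
  rw [hαε] at h₂
  -- `E` is the slack of the argument: close pairs are sought at distance `E m s`, and centres
  -- within `G/(2E)` of the common point are discarded.
  obtain ⟨E, hE⟩ : ∃ E : ℝ, E = (P.R : ℝ) ^ (5 * ε / (2 * P.β)) := ⟨_, rfl⟩
  have hEβ : 160 * (b₂ / b₁) ^ 2 * (P.R : ℝ) ^ ε ≤ E ^ P.β := hE ▸ rpow_ge_mul_rpow hR' hρ hβ hRε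
  have hE1 : 1 ≤ E := hE ▸ Real.one_le_rpow hR1 (by positivity)
  have hE0 : 0 < E := by linarith
  have hi1 : P.i = 1 - P.j := by linarith
  have hj1 : P.j = 1 - P.i := by linarith
  have hEi : 96 * E ^ (1 + 2 * P.i) ≤ (P.R : ℝ) ^ (P.α * P.i) := hE ▸
    mul_rpow_le_rpow hR' hρ hε hβ hβ1 hi (by linarith) (by rw [← hj1]; rfl) hRε
      (by rw [← hj1]; exact h₂)
  have hEj : 96 * E ^ (1 + 2 * P.j) ≤ (P.R : ℝ) ^ (P.α * P.j) := hE ▸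
    mul_rpow_le_rpow hR' hρ hε hβ hβ1 hj (by linarith)
      (by rw [← hi1, Params.α]; ring) hRε
      (by rw [← hi1, mul_comm P.j P.i]; exact h₂)
  have hER : 96 * E ≤ (P.R : ℝ) ^ P.α := by
    calc 96 * E ≤ 96 * E ^ (1 + 2 * P.j) := by
          gcongr
          exact Real.self_le_rpow_of_one_le hE1 (by linarith)
      _ ≤ (P.R : ℝ) ^ (P.α * P.j) := hEj
      _ ≤ (P.R : ℝ) ^ P.α := Real.rpow_le_rpow_of_exponent_le hR1
        (mul_le_of_le_one_right hα0.le (by linarith))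
  have hαR : (P.R : ℝ) ^ P.α ≤ P.R := by
    calc (P.R : ℝ) ^ P.α ≤ (P.R : ℝ) ^ (1 : ℝ) := Real.rpow_le_rpow_of_exponent_le hR1 hα1
      _ = P.R := Real.rpow_one _
  -- the lines
  have hZne : Z.Nonempty := Finset.card_pos.1 (Nat.cast_pos.1
    ((by positivity : (0 : ℝ) ≤ (P.R : ℝ) ^ (P.β - ε)).trans_lt hcard))
  have hline : ∀ z : ℝ, ∃ L : Line, z ∈ Z → L ∈ P.linesAtLevelScale n l k ∧
      (P.interval (n + 1) z ∩ P.Δ L).Nonempty := by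
    intro z
    by_cases hz : z ∈ Z
    · obtain ⟨-, L, hL, hL'⟩ := hZ (Finset.mem_coe.2 hz)
      exact ⟨L, fun _ => ⟨hL, hL'⟩⟩
    · exact ⟨⟨0, 0, 0⟩, fun h => absurd h hz⟩
  choose f hf using hline
  have hK1 : (1 : ℝ) ≤ 2 ^ k := one_le_pow₀ (by norm_num)
  have hKR : (2 : ℝ) ^ k ≤ P.R := by
    obtain ⟨z, hz⟩ := hZne
    obtain ⟨hL, -⟩ := hf z hz
    have h3 := hL.2.1.trans hL.1.1.2.2.2.le
    rw [show (n : ℝ) = 1 + ((n : ℝ) - 1) by ring, add_sub_cancel_left,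
      Real.rpow_add hR0, Real.rpow_one] at h3
    exact le_of_mul_le_mul_right h3 (by positivity)
  -- `mG` dominates both the half-width of every `Δ(L)` in the class and twice the radius of
  -- generation `n + 1`.
  obtain ⟨m, hm⟩ : ∃ m : ℝ, m = max ((P.R : ℝ)⁻¹) ((2 ^ k : ℝ)⁻¹ * (P.R : ℝ) ^ (-P.α)) :=
    ⟨_, rfl⟩
  have hmR : 1 ≤ m * P.R := by
    rw [← inv_le_iff_one_le_mul₀ hR0, hm]; exact le_max_left _ _
  have hm0 : 0 < m := by rw [hm]; exact lt_max_of_lt_left (by positivity)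
  have hmα : m * (P.R : ℝ) ^ P.α ≤ 1 := by
    rw [← le_div_iff₀ (by positivity), one_div, hm]
    refine max_le (inv_anti₀ (by positivity) hαR) ?_
    rw [Real.rpow_neg hR0.le]
    exact mul_le_of_le_one_left (by positivity) (inv_le_one_of_one_le₀ hK1)
  have hEm : 96 * E * m ≤ 1 := by
    refine le_trans ?_ hmα
    rw [mul_comm m]; gcongr
  have hm96 : 96 * m ≤ 1 := by linarith [le_mul_of_one_le_left hm0.le hE1]
  obtain ⟨G, hG⟩ : ∃ G : ℝ, G = P.c₁ * (P.R : ℝ) ^ (-(n : ℝ)) := ⟨_, rfl⟩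
  have hG0 : 0 < G := by rw [hG]; positivity
  obtain ⟨s, hs⟩ : ∃ s : ℝ, s = G * (P.R : ℝ) ^ l := ⟨_, rfl⟩
  have hGs : G ≤ s := by rw [hs]; exact le_mul_of_one_le_right hG0.le (one_le_pow₀ hR1)
  have hs0 : 0 < s := by linarith
  have hsr : s = 2 * P.radius (n - l) := by
    rw [hs, hG, Params.radius, Nat.cast_sub hl, ← Real.rpow_natCast, mul_assoc,
      ← Real.rpow_add hR0]
    ring_nf
  have hs4 : s ≤ 1 / 4 := by
    have h3 : (P.R : ℝ) ^ (-((n - l : ℕ) : ℝ)) ≤ 1 :=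
      Real.rpow_le_one_of_one_le_of_nonpos hR1 (by rw [neg_nonpos]; positivity)
    have h4 := Params.c₁_le hi hj hR'
    rw [hsr, Params.radius]
    linarith [mul_le_of_le_one_right hc₁.le h3]
  have hr : P.radius (n + 1) = G / (2 * P.R) := by
    rw [Params.radius, hG, Nat.cast_add, Nat.cast_one, neg_add, Real.rpow_add hR0,
      Real.rpow_neg_one]
    field_simp
  have hr0 : 0 < G / (2 * P.R) := by positivity
  have hrG : G / (2 * P.R) ≤ G / 2 := by
    gcongr; linarith
  -- the centres
  have hZI : ∀ z ∈ Z, z ∈ T.I (n + 1) := fun z hz => (hZ (Finset.mem_coe.2 hz)).1.1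
  have hZsupp : ∀ z ∈ Z, z ∈ μ.support := fun z hz => Choices.I_subset_support hT _ (hZI z hz)
  have hZdisj : (Z : Set ℝ).PairwiseDisjoint (fun z => Metric.closedBall z (G / (2 * P.R))) := by
    rw [← hr]
    exact (Choices.pairwiseDisjoint_I hT hc₁ hR hα1 (n + 1)).subset fun z hz => hZI z hz
  have hZJ : ∀ z ∈ Z, z ∈ P.interval (n - l) y := fun z hz =>
    (hZ (Finset.mem_coe.2 hz)).1.2 (Metric.mem_closedBall_self (Params.radius_pos hc₁ hR _).le)
  have hZdist : ∀ z ∈ Z, ∀ z' ∈ Z, dist z z' ≤ s := by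
    intro z hz z' hz'
    have h3 := Metric.mem_closedBall.1 (hZJ z hz)
    have h4 := Metric.mem_closedBall'.1 (hZJ z' hz')
    linarith [dist_triangle z y z']
  have hnear : ∀ z ∈ Z, |z - (f z).ordinate P.θ| ≤ 3 / 2 * m * G := fun z hz =>
    Params.abs_center_sub_ordinate_le hR' hc₁ (hf z hz).1 (hf z hz).2 hG hm
  have hord : ∀ z ∈ Z, ∀ z' ∈ Z,
      |(f z).ordinate P.θ - (f z').ordinate P.θ| ≤ dist z z' + 3 * m * G := by
    intro z hz z' hz'
    have h3 := hnear z hz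
    have h4 := hnear z' hz'
    rw [Real.dist_eq]
    have h5 := le_abs_self (z - z')
    have h6 := neg_abs_le (z - z')
    rw [abs_le] at *
    constructor <;> linarith [h3.1, h3.2, h4.1, h4.2]
  obtain ⟨hcov, hcov'⟩ := covering_number_bounds hR' hE1 (by linarith) hm0 hmR (by linarith)
    hρ hβ hβ1 hEβ
  have hmG : 3 * m * G ≤ G / 32 := by linarith [mul_le_of_le_one_left hG0.le hm96]
  -- Half of the count is enough for a pair, so the far centres still qualify once the near ones are
  -- discarded.
  have hpair : ∀ Z' ⊆ Z, (P.R : ℝ) ^ (P.β - ε) / 2 < Z'.card →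
      ∃ z ∈ Z', ∃ z' ∈ Z', f z ≠ f z' ∧ dist z z' ≤ E * m * s := by
    intro Z' hZ' hcard'
    have hη : 0 < E * m * s := by positivity
    have hηs : E * m * s ≤ s := mul_le_of_le_one_left hs0.le (by linarith)
    refine hμ.exists_close_pair (r := G / (2 * P.R)) (s := s) (d := 3 * m * G) hr0
      (by positivity) (by linarith) hη hs0.le (by linarith) (fun z hz => hZsupp z (hZ' hz))
      (hZdisj.subset (Finset.coe_subset.2 hZ'))
      (fun z hz z' hz' => hZdist z (hZ' hz) z' (hZ' hz')) f ?_ ?_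
    · intro z hz z' hz' he
      have h3 := hnear z (hZ' hz)
      have h4 := hnear z' (hZ' hz')
      rw [← he] at h4
      rw [Real.dist_eq]
      rw [abs_le] at *
      constructor <;> linarith [h3.1, h3.2, h4.1, h4.2]
    · refine lt_of_eq_of_lt ?_ (hcov.trans_lt hcard')
      congr 3
      · field_simp; ring
      · field_simp
  -- the common point of the lines
  obtain ⟨p, t, q, hq, hprim, hcommon⟩ : ∃ (p t : ℤ) (q : ℕ), 0 < q ∧
      Int.gcd (Int.gcd p t) q = 1 ∧
      ∀ L ∈ f '' (Z : Set ℝ), L.A * p - L.B * t + L.C * q = 0 := by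
    refine Params.exists_common_point hi hj hij hR' (σ := s + 3 * m * G) (n := n) (l := l) ?_ ?_
      ?_ ?_
    · rintro _ ⟨z, hz, rfl⟩
      exact (hf z hz).1.1
    · rw [← hG, ← hs]; linarith
    · rintro _ ⟨z, hz, rfl⟩ _ ⟨z', hz', rfl⟩
      exact (hord z hz z' hz').trans (by linarith [hZdist z hz z' hz'])
    · have h0 : (0 : ℝ) ≤ (P.R : ℝ) ^ (P.β - ε) := by positivity
      obtain ⟨z, hz, z', hz', hne, -⟩ := hpair Z subset_rfl (by linarith)
      exact ⟨f z, ⟨z, hz, rfl⟩, f z', ⟨z', hz', rfl⟩, hne⟩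
  -- the centres far from the common point
  have hfar : (P.R : ℝ) ^ (P.β - ε) / 2 <
      ((Z.filter fun z : ℝ => ¬ |z - t / q| ≤ G / (2 * E)).card : ℝ) := by
    have hclose : ((Z.filter fun z : ℝ => |z - t / q| ≤ G / (2 * E)).card : ℝ) ≤
        (P.R : ℝ) ^ (P.β - ε) / 2 := by
      have hGE : G / E ≤ G := div_le_self hG0.le hE1
      refine le_trans (hμ.card_le (r := G / (2 * P.R)) (D := G / E) hr0 (by positivity)
        (by linarith) (fun z hz => hZsupp z (Finset.mem_filter.1 hz).1)
        (hZdisj.subset (Finset.coe_subset.2 (Finset.filter_subset _ _))) ?_) (le_trans ?_ hcov')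
      · intro z hz z' hz'
        have h3 := (Finset.mem_filter.1 hz).2
        have h4 := (Finset.mem_filter.1 hz').2
        have e : G / E = G / (2 * E) + G / (2 * E) := by field_simp; norm_num
        rw [Real.dist_eq, e]
        rw [abs_sub_comm] at h4
        exact (abs_sub_le _ _ _).trans (add_le_add h3 h4)
      · refine le_of_eq ?_
        congr 2
        field_simp
    have h3 := Finset.card_filter_add_card_filter_not (s := Z)
      (fun z : ℝ => |z - t / q| ≤ G / (2 * E))
    have h4 : ((Z.filter fun z : ℝ => |z - t / q| ≤ G / (2 * E)).card : ℝ) +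
        ((Z.filter fun z : ℝ => ¬ |z - t / q| ≤ G / (2 * E)).card : ℝ) = Z.card := by
      exact_mod_cast h3
    linarith
  obtain ⟨z, hz, z', hz', hne, hzz⟩ := hpair _ (Finset.filter_subset _ _) hfar
  rw [Finset.mem_filter, not_le] at hz hz'
  have hsep : ∀ x ∈ Z, G / (2 * E) < |x - t / q| → G / (4 * E) ≤ |(f x).ordinate P.θ - t / q| := by
    intro x hx hxt
    have h3 := hnear x hx
    have h4 : 3 / 2 * m * G ≤ G / (4 * E) := by
      rw [le_div_iff₀ (by positivity)]
      linarith [mul_le_of_le_one_left hG0.le hEm]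
    have e : G / (2 * E) = G / (4 * E) + G / (4 * E) := by field_simp; norm_num
    have h5 := abs_sub_le x ((f x).ordinate P.θ) (t / q : ℝ)
    linarith
  have hmG' : 3 / 2 * m * G ≤ 2 * m * G := by gcongr; norm_num
  -- a line of small height
  obtain ⟨M, hM, hM1, hMR, hzM⟩ := Params.exists_low_line hi hj hij hθ hR' hc₁ (E := E) (m := m)
    (G := G) (s := s) hE1 hm0 (by linarith) (by linarith)
    (rpow_mul_le_rpow_neg hR' hα0 hαi (by linarith) hK1 hKR hE1 hm hEi)
    (rpow_mul_le_rpow_neg hR' hα0 hαj (by linarith) hK1 hKR hE1 hm hEj) hG hs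
    (hf z hz.1).1 (hf z' hz'.1).1 hne hq hprim (hcommon _ ⟨z, hz.1, rfl⟩)
    (hcommon _ ⟨z', hz'.1, rfl⟩)
    -- The distance of the centres and the error `3mG` each contribute at most `E m s`, whence the
    -- factor `2`.
    (by
      refine (hord z hz.1 z' hz'.1).trans ?_
      have h3 : 3 * m * G ≤ E * m * s := by
        have h160 : 160 ≤ E := by
          have h4 : E ^ P.β ≤ E := by
            calc E ^ P.β ≤ E ^ (1 : ℝ) := Real.rpow_le_rpow_of_exponent_le hE1 hβ1
              _ = E := Real.rpow_one E
          have h5 := one_le_mul_of_one_le_of_one_le (one_le_pow₀ hρ : 1 ≤ (b₂ / b₁) ^ 2)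
            (Real.one_le_rpow hR1 hε.le)
          linarith
        gcongr; linarith
      linarith)
    (hsep z hz.1 hz.2) (hsep z' hz'.1 hz'.2) (hsupp (hZsupp z hz.1)) (hsupp (hZsupp z' hz'.1))
    ((hnear z hz.1).trans hmG') ((hnear z' hz'.1).trans hmG')
  obtain ⟨m₀, hm₀, hMm₀⟩ := Params.exists_mem_linesAt hR' hM hM1 (N := n - l)
    (by rw [Nat.cast_sub hl]; exact hMR)
  have hdis := Choices.disjoint_Δ_of_mem_J hT hc₁ hR hα1 hm₀ hy hMm₀
  rcases hzM with h | h
  · exact Set.disjoint_left.1 hdis h (hZJ z hz.1)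
  · exact Set.disjoint_left.1 hdis h (hZJ z' hz'.1)
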